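/- Let $m_1,m_2,m_3>0$ with $m_1+m_2+m_3=1$. Write a configuration of three bodies in the complexified plane as $q=(x_1,x_2,x_3,y_1,y_2,y_3)\in\mathbb{C}^6$, put $m_{i+3}=m_i$, and let $$V(q)=\sum_{i>j}\frac{m_im_j}{r_{ij}(q)},\qquad r_{ij}(q)^2=(x_i-x_j)^2+(y_i-y_j)^2,$$ where near a configuration with all $r_{ij}^2\ne0$ every choice of holomorphic branches of the $r_{ij}$ is allowed. A Darboux point (central configuration) of $V$ with multiplier $-1$ is a $c\in\mathbb{C}^6$ with all $r_{ij}(c)^2\neq0$, together with a choice of branches near $c$, such that $$\frac{\partial V}{\partial q_k}(c)=-m_kc_k,\qquad k=1,\dots,6 .$$ If moreover $\sum_{k=1}^6 m_kc_k^2\neq 0$, there are conic orbits over $c$; let $W\in M_6(\mathbb{C})$ be the matrix $W_{k,l}=\frac1{m_k}\frac{\partial^2V}{\partial q_k\partial q_l}(c)$ and $$R_\theta=\begin{pmatrix}\cos\theta\, I_3&-\sin\theta\, I_3\\ \sin\theta\, I_3&\cos\theta\, I_3\end{pmatrix},\qquad\theta\in\mathbb{C}.$$ The variational equation near a conic orbit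 over $c$ is called partially decoupled if there are $\lambda\in\mathbb{C}$ and a linear subspace $\tilde V\subset\mathbb{C}^6$, not contained in the space $\{(a,a,a,b,b,b): a,b\in\mathbb{C}\}$ of translations, such that $Wv=\lambda v$ for all $v\in\tilde V$ and $R_\theta\tilde V\subset\tilde V$ for all $\theta\in\mathbb{C}$. Theorem. $V$ possesses a Darboux point $c$ with multiplier $-1$ and $\sum_k m_kc_k^2\ne0$ such that the variational equation near a conic orbit over $c$ is partially decoupled if and only if, up to a permutation, $(m_1,m_2,m_3)$ is one of $$\left(\tfrac13,\tfrac13,\tfrac13\right),\qquad\left(\tfrac17,\tfrac57,\tfrac17\right),$$ $$\left(\tfrac14+\tfrac{\sqrt{21}+\sqrt{126+42\sqrt{21}}}{84},\ \tfrac12-\tfrac{\sqrt{21}}{42},\ \tfrac14+\tfrac{\sqrt{21}-\sqrt{126+42\sqrt{21}}}{84}\right).$$ -/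

import Mathlib

open scoped Topology

namespace PlanarNBody

/-- The complexified configuration space `ℂ²ⁿ` of `n` bodies in the plane. The entry `inl i` is the
first and the entry `inr i` the second coordinate of the body `i`. -/
abbrev Config (n : ℕ) : Type := Fin n ⊕ Fin n → ℂ

/-- The mass attached to a coordinate: both coordinates of the body `i` carry the mass `m i`. -/
def coordMass {n : ℕ} (m : Fin n → ℝ) : Fin n ⊕ Fin n → ℝ := Sum.elim m m

/-- The complex squared distance `(xᵢ - xⱼ)² + (yᵢ - yⱼ)²` between two bodies. -/
def sqDist {n : ℕ} (i j : Fin n) (q : Config n) : ℂ :=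
  (q (.inl i) - q (.inl j)) ^ 2 + (q (.inr i) - q (.inr j)) ^ 2

/-- `r` is a holomorphic branch near `c` of the mutual distances: for each pair `j < i` the squared
distance at `c` is not zero and `r i j` is, near `c`, a holomorphic square root of the squared
distance. (All `2 ^ (n.choose 2)` choices of signs are allowed.) -/
def IsDistanceBranch {n : ℕ} (r : Fin n → Fin n → Config n → ℂ) (c : Config n) : Prop :=
  ∀ i j : Fin n, j < i →
    sqDist i j c ≠ 0 ∧ AnalyticAt ℂ (r i j) c ∧ ∀ᶠ q in 𝓝 c, r i j q ^ 2 = sqDist i j q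

/-- The potential `∑_{i > j} mᵢ mⱼ / rᵢⱼ` of the `n`-body problem for the distances `r`. -/
noncomputable def potential {n : ℕ} (m : Fin n → ℝ) (r : Fin n → Fin n → Config n → ℂ)
    (q : Config n) : ℂ :=
  ∑ i : Fin n, ∑ j : Fin n with j < i, ((m i : ℂ) * (m j : ℂ)) / r i j q

/-- The partial derivative of `F` with respect to the coordinate `k`. -/
noncomputable def partialDeriv {n : ℕ} (k : Fin n ⊕ Fin n) (F : Config n → ℂ) (q : Config n) : ℂ :=
  fderiv ℂ F q (Pi.single k 1)

/-- `c` is a Darboux point (central configuration) of `V` with multiplier `α`, for the masses `m`: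
`∂V/∂q_k (c) = α m_k c_k`. In the coordinates `√m_k q_k`, in which the kinetic energy is the
standard one, this reads `∇V(c) = α c`. -/
def IsDarbouxPoint {n : ℕ} (m : Fin n → ℝ) (V : Config n → ℂ) (c : Config n) (α : ℂ) : Prop :=
  ∀ k, partialDeriv k V c = α * ((coordMass m k : ℂ) * c k)

/-- The complex "square norm" `∑ m_k c_k²` of `c`, in the coordinates `√m_k q_k`. -/
noncomputable def massNormSq {n : ℕ} (m : Fin n → ℝ) (c : Config n) : ℂ :=
  ∑ k, (coordMass m k : ℂ) * c k ^ 2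

/-- The matrix `W_{k,l} = (1 / m_k) ∂²V / ∂q_k ∂q_l (c)`. -/
noncomputable def hessianMatrix {n : ℕ} (m : Fin n → ℝ) (V : Config n → ℂ) (c : Config n) :
    Matrix (Fin n ⊕ Fin n) (Fin n ⊕ Fin n) ℂ :=
  Matrix.of fun k l => 1 / (coordMass m k : ℂ) * partialDeriv k (partialDeriv l V) c

/-- The simultaneous rotation of all bodies by the complex angle `θ`. -/
noncomputable def rotation (n : ℕ) (θ : ℂ) : Matrix (Fin n ⊕ Fin n) (Fin n ⊕ Fin n) ℂ :=
  Matrix.fromBlocks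
    (Complex.cos θ • (1 : Matrix (Fin n) (Fin n) ℂ)) (-Complex.sin θ • (1 : Matrix (Fin n) (Fin n) ℂ))
    (Complex.sin θ • (1 : Matrix (Fin n) (Fin n) ℂ)) (Complex.cos θ • (1 : Matrix (Fin n) (Fin n) ℂ))

/-- The space of the simultaneous translations of all bodies (the motion of the centre of mass). -/
def translations (n : ℕ) : Submodule ℂ (Config n) :=
  Submodule.span ℂ {Sum.elim (fun _ => 1) (fun _ => 0), Sum.elim (fun _ => 0) (fun _ => 1)}

/-- The variational equation near a conic orbit over `c` is partially decoupled: some nontrivial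
space, on which `W` is a scalar, is stable under all rotations. The translations always form such a
space, with scalar `0`, so that nontrivial means: not made of translations only. -/
def IsPartiallyDecoupled {n : ℕ} (m : Fin n → ℝ) (V : Config n → ℂ) (c : Config n) : Prop :=
  ∃ (U : Submodule ℂ (Config n)) (μ : ℂ),
    ¬ U ≤ translations n ∧
    (∀ v ∈ U, (hessianMatrix m V c).mulVec v = μ • v) ∧
    ∀ θ : ℂ, ∀ v ∈ U, (rotation n θ).mulVec v ∈ U

end PlanarNBody

/-! A rotation-stable space on which `W` is scalar, if not made of translations, contains an
eigenvector of the quarter turn: an isotropic vector (a, e a) with e² = -1 and a nonconstant. Put z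
= x + e y, w = x - e y and write z_ij, w_ij for differences, so that r_ij² = z_ij w_ij. The
eigenvector equation then splits into the families `isotropic` and `eigen` of `DecoupledData`. The
first says that m_i m_j (a_i - a_j) / (r_ij w_ij²) is a divergence-free flow on the edges of the
triangle, hence a constant circulation. Since the differences of a sum to zero around the triangle,
one relation remains, ∑ m_k r_ij w_ij² = 0 with k opposite to ij (`sum_dist_mul_sq`).

If the bodies are not collinear, the central equations force r_ij³ = 1 (`eq_one_of_central`), with
complex cube roots allowed. If they are, r_ij = ±κ w_ij and the relation becomes ∑ ±m_k w_ij³ = 0.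
This leaves finitely many choices of roots or signs. In those that are not contradictory, the ratio
of two of the w_ij is a nonreal root of an explicit polynomial, so the relation between the real
masses splits into two real equations, which determine them.

Conversely, explicit triangles realise the three mass triples. There `eigen` costs nothing: it holds
with μ = 1 for centred a when all r_ij³ = 1, and it coincides with `isotropic` for μ = 0 when z = w
and r_ij = ±w_ij. -/

namespace PlanarNBody

/-! ### Gradient and Hessian of the potential. -/

/-- The polar form of `sqDist i j`, as a linear form in its second argument. -/
noncomputable def pairForm {n : ℕ} (i j : Fin n) (q : Config n) : Config n →L[ℂ] ℂ :=
  (q (.inl i) - q (.inl j)) • (ContinuousLinearMap.proj (R := ℂ) (φ := fun _ : Fin n ⊕ Fin n => ℂ) (.inl i) - ContinuousLinearMap.proj (.inl j)) +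
  (q (.inr i) - q (.inr j)) • (ContinuousLinearMap.proj (R := ℂ) (φ := fun _ : Fin n ⊕ Fin n => ℂ) (.inr i) - ContinuousLinearMap.proj (.inr j))

lemma pairForm_apply {n : ℕ} (i j : Fin n) (q v : Config n) :
    pairForm i j q v = (q (.inl i) - q (.inl j)) * (v (.inl i) - v (.inl j)) +
      (q (.inr i) - q (.inr j)) * (v (.inr i) - v (.inr j)) := by
  simp [pairForm]

lemma pairForm_comm {n : ℕ} (i j : Fin n) (q v : Config n) :
    pairForm i j q v = pairForm i j v q := by
  simp only [pairForm_apply]; ring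

lemma hasFDerivAt_pairForm_left {n : ℕ} (i j : Fin n) (v q : Config n) :
    HasFDerivAt (fun q => pairForm i j q v) (pairForm i j v) q := by
  simp_rw [fun q => pairForm_comm i j q v]
  exact (pairForm i j v).hasFDerivAt

lemma hasFDerivAt_sqDist {n : ℕ} (i j : Fin n) (q : Config n) :
    HasFDerivAt (sqDist i j) ((2 : ℂ) • pairForm i j q) q := by
  have h (k : Fin n ⊕ Fin n) : HasFDerivAt (fun q : Config n => q k)
      (ContinuousLinearMap.proj (R := ℂ) (φ := fun _ : Fin n ⊕ Fin n => ℂ) k) q :=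
    (ContinuousLinearMap.proj (R := ℂ) (φ := fun _ : Fin n ⊕ Fin n => ℂ) k).hasFDerivAt
  have := (((h (.inl i)).sub (h (.inl j))).pow 2).add (((h (.inr i)).sub (h (.inr j))).pow 2)
  refine HasFDerivAt.congr_fderiv this ?_
  ext v
  simp [pairForm_apply]
  ring

/-- Differentiate f² = `sqDist`. The formula is needed on a neighbourhood because it is
differentiated once more for the Hessian. -/
lemma eventually_hasFDerivAt_of_sq_eq {n : ℕ} {i j : Fin n} {c : Config n} {f : Config n → ℂ}
    (h0 : sqDist i j c ≠ 0) (hf : AnalyticAt ℂ f c) (hsq : ∀ᶠ q in 𝓝 c, f q ^ 2 = sqDist i j q) :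
    ∀ᶠ q in 𝓝 c, f q ≠ 0 ∧ HasFDerivAt f ((f q)⁻¹ • pairForm i j q) q := by
  have hne : ∀ᶠ q in 𝓝 c, f q ≠ 0 := hf.continuousAt.eventually_ne fun h => h0 <| by
    rw [← hsq.self_of_nhds, h]; simp
  filter_upwards [hne, hsq.eventually_nhds, hf.eventually_analyticAt] with q hq hsq hf
  refine ⟨hq, ?_⟩
  have h1 := hf.differentiableAt.hasFDerivAt
  have h2 := (h1.pow 2).unique ((hasFDerivAt_sqDist i j q).congr_of_eventuallyEq hsq)
  refine h1.congr_fderiv ?_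
  ext v
  have h3 := DFunLike.congr_fun h2 v
  simp at h3 ⊢
  field_simp
  linear_combination h3 / 2

lemma eventually_hasFDerivAt_potential {n : ℕ} (m : Fin n → ℝ)
    {r : Fin n → Fin n → Config n → ℂ} {c : Config n} (hr : IsDistanceBranch r c) :
    ∀ᶠ q in 𝓝 c, HasFDerivAt (potential m r)
      (∑ i : Fin n, ∑ j : Fin n with j < i,
        (-((m i : ℂ) * (m j : ℂ)) / r i j q ^ 3) • pairForm i j q) q := by
  have h : ∀ᶠ q in 𝓝 c, ∀ i j : Fin n, j < i →
      r i j q ≠ 0 ∧ HasFDerivAt (r i j) ((r i j q)⁻¹ • pairForm i j q) q := by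
    simp only [Filter.eventually_all]
    exact fun i j hij => eventually_hasFDerivAt_of_sq_eq (hr i j hij).1 (hr i j hij).2.1
      (hr i j hij).2.2
  filter_upwards [h] with q hq
  unfold potential
  refine HasFDerivAt.fun_sum fun i _ => HasFDerivAt.fun_sum fun j hj => ?_
  obtain ⟨h0, h1⟩ := hq i j (Finset.mem_filter.1 hj).2
  have h2 := ((hasDerivAt_inv h0).comp_hasFDerivAt q h1).const_mul ((m i : ℂ) * (m j : ℂ))
  refine (h2.congr_fderiv ?_)
  ext v
  simp
  field_simp

lemma partialDeriv_potential {n : ℕ} (m : Fin n → ℝ)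
    {r : Fin n → Fin n → Config n → ℂ} {c : Config n} (hr : IsDistanceBranch r c)
    (k : Fin n ⊕ Fin n) :
    partialDeriv k (potential m r) c = ∑ i : Fin n, ∑ j : Fin n with j < i,
      (-((m i : ℂ) * (m j : ℂ)) / r i j c ^ 3) * pairForm i j c (Pi.single k 1) := by
  rw [partialDeriv, (eventually_hasFDerivAt_potential m hr).self_of_nhds.fderiv]
  simp

lemma partialDeriv_partialDeriv_potential {n : ℕ} (m : Fin n → ℝ)
    {r : Fin n → Fin n → Config n → ℂ} {c : Config n} (hr : IsDistanceBranch r c)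
    (k l : Fin n ⊕ Fin n) :
    partialDeriv k (partialDeriv l (potential m r)) c = ∑ i : Fin n, ∑ j : Fin n with j < i,
      ((m i : ℂ) * (m j : ℂ)) *
        (3 / r i j c ^ 5 * pairForm i j c (Pi.single k 1) * pairForm i j c (Pi.single l 1) -
          1 / r i j c ^ 3 * pairForm i j (Pi.single k 1) (Pi.single l 1)) := by
  have h : partialDeriv l (potential m r) =ᶠ[𝓝 c] fun q => ∑ i : Fin n, ∑ j : Fin n with j < i,
      (-((m i : ℂ) * (m j : ℂ))) * ((r i j q ^ 3)⁻¹ * pairForm i j q (Pi.single l 1)) := by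
    filter_upwards [eventually_hasFDerivAt_potential m hr] with q hq
    rw [partialDeriv, hq.fderiv]
    simp [div_eq_mul_inv, mul_assoc]
  have h2 : HasFDerivAt (fun q => ∑ i : Fin n, ∑ j : Fin n with j < i,
      (-((m i : ℂ) * (m j : ℂ))) * ((r i j q ^ 3)⁻¹ * pairForm i j q (Pi.single l 1)))
      (∑ i : Fin n, ∑ j : Fin n with j < i, (-((m i : ℂ) * (m j : ℂ))) •
        ((r i j c ^ 3)⁻¹ • pairForm i j (Pi.single l 1) + pairForm i j c (Pi.single l 1) •
          ((-3 / r i j c ^ 4) • (r i j c)⁻¹ • pairForm i j c))) c := by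
    refine HasFDerivAt.fun_sum fun i _ => HasFDerivAt.fun_sum fun j hj => ?_
    obtain ⟨ha, hb, hc⟩ := hr i j (Finset.mem_filter.1 hj).2
    obtain ⟨h0, h1⟩ := (eventually_hasFDerivAt_of_sq_eq ha hb hc).self_of_nhds
    have h3 := (hasDerivAt_inv (pow_ne_zero 3 h0)).comp_hasFDerivAt c (h1.pow 3)
    have h4 := (h3.mul (hasFDerivAt_pairForm_left i j (Pi.single l 1) c)).const_mul
      (-((m i : ℂ) * (m j : ℂ)))
    refine h4.congr_fderiv ?_
    ext v
    simp
    field_simp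
  rw [partialDeriv, h.fderiv_eq, h2.fderiv]
  simp only [sum_apply, smul_apply,
    add_apply, smul_eq_mul]
  refine Finset.sum_congr rfl fun i _ => Finset.sum_congr rfl fun j hj => ?_
  obtain ⟨ha, hb, hc⟩ := hr i j (Finset.mem_filter.1 hj).2
  obtain ⟨h0, h1⟩ := (eventually_hasFDerivAt_of_sq_eq ha hb hc).self_of_nhds
  rw [pairForm_comm i j (Pi.single l 1)]
  field_simp
  ring

lemma sum_single_smul_eq {n : ℕ} (f : Config n →L[ℂ] ℂ) (v : Config n) :
    ∑ l, f (Pi.single l 1) * v l = f v := by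
  conv_rhs => rw [pi_eq_sum_univ' v]
  simp [mul_comm]

lemma hessianMatrix_mulVec {n : ℕ} (m : Fin n → ℝ)
    {r : Fin n → Fin n → Config n → ℂ} {c : Config n} (hr : IsDistanceBranch r c)
    (v : Config n) (k : Fin n ⊕ Fin n) :
    (hessianMatrix m (potential m r) c).mulVec v k =
      1 / (coordMass m k : ℂ) * ∑ i : Fin n, ∑ j : Fin n with j < i,
      ((m i : ℂ) * (m j : ℂ)) *
        (3 / r i j c ^ 5 * pairForm i j c (Pi.single k 1) * pairForm i j c v -
          1 / r i j c ^ 3 * pairForm i j v (Pi.single k 1)) := by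
  simp only [Matrix.mulVec, dotProduct, hessianMatrix, Matrix.of_apply,
    partialDeriv_partialDeriv_potential m hr]
  simp only [Finset.mul_sum, Finset.sum_mul]
  rw [Finset.sum_comm]
  refine Finset.sum_congr rfl fun i _ => ?_
  rw [Finset.sum_comm]
  refine Finset.sum_congr rfl fun j hj => ?_
  rw [← sum_single_smul_eq (pairForm i j c) v, pairForm_comm i j v,
    ← sum_single_smul_eq (pairForm i j (Pi.single k 1)) v]
  simp only [Finset.mul_sum, ← Finset.sum_sub_distrib]
  refine Finset.sum_congr rfl fun l _ => ?_
  ring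

/-- The values at `c` of the mutual distances, as a symmetric function of the two bodies. -/
def distAt {n : ℕ} (r : Fin n → Fin n → Config n → ℂ) (c : Config n) (i j : Fin n) : ℂ :=
  if j < i then r i j c else r j i c

lemma sum_lt_fin_three (f : Fin 3 → Fin 3 → ℂ) :
    ∑ i : Fin 3, ∑ j : Fin 3 with j < i, f i j = f 1 0 + f 2 0 + f 2 1 := by
  simp only [Finset.sum_filter, Fin.sum_univ_three]
  simp
  ring

lemma partialDeriv_inl (m : Fin 3 → ℝ) {r : Fin 3 → Fin 3 → Config 3 → ℂ} {c : Config 3}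
    (hr : IsDistanceBranch r c) (i : Fin 3) :
    partialDeriv (.inl i) (potential m r) c =
      -((m i : ℂ) * ∑ j, (m j : ℂ) * (c (.inl i) - c (.inl j)) / distAt r c i j ^ 3) := by
  rw [partialDeriv_potential m hr, sum_lt_fin_three]
  simp only [pairForm_apply, Fin.sum_univ_three, distAt]
  fin_cases i <;> simp <;> ring

lemma partialDeriv_inr (m : Fin 3 → ℝ) {r : Fin 3 → Fin 3 → Config 3 → ℂ} {c : Config 3}
    (hr : IsDistanceBranch r c) (i : Fin 3) :
    partialDeriv (.inr i) (potential m r) c =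
      -((m i : ℂ) * ∑ j, (m j : ℂ) * (c (.inr i) - c (.inr j)) / distAt r c i j ^ 3) := by
  rw [partialDeriv_potential m hr, sum_lt_fin_three]
  simp only [pairForm_apply, Fin.sum_univ_three, distAt]
  fin_cases i <;> simp <;> ring

lemma hessianMatrix_mulVec_inl {m : Fin 3 → ℝ} (hm : ∀ i, 0 < m i)
    {r : Fin 3 → Fin 3 → Config 3 → ℂ} {c : Config 3}
    (hr : IsDistanceBranch r c) (v : Config 3) (i : Fin 3) :
    (hessianMatrix m (potential m r) c).mulVec v (.inl i) =
      ∑ j, (m j : ℂ) * (3 / distAt r c i j ^ 5 * (c (.inl i) - c (.inl j)) * pairForm i j c v -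
        1 / distAt r c i j ^ 3 * (v (.inl i) - v (.inl j))) := by
  have h (i) : (m i : ℂ) ≠ 0 := by exact_mod_cast (hm i).ne'
  rw [hessianMatrix_mulVec m hr, sum_lt_fin_three, show coordMass m (.inl i) = m i from rfl,
    one_div, inv_mul_eq_iff_eq_mul₀ (h i)]
  simp only [pairForm_apply, Fin.sum_univ_three, distAt]
  fin_cases i <;> simp <;> ring

lemma hessianMatrix_mulVec_inr {m : Fin 3 → ℝ} (hm : ∀ i, 0 < m i)
    {r : Fin 3 → Fin 3 → Config 3 → ℂ} {c : Config 3}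
    (hr : IsDistanceBranch r c) (v : Config 3) (i : Fin 3) :
    (hessianMatrix m (potential m r) c).mulVec v (.inr i) =
      ∑ j, (m j : ℂ) * (3 / distAt r c i j ^ 5 * (c (.inr i) - c (.inr j)) * pairForm i j c v -
        1 / distAt r c i j ^ 3 * (v (.inr i) - v (.inr j))) := by
  have h (i) : (m i : ℂ) ≠ 0 := by exact_mod_cast (hm i).ne'
  rw [hessianMatrix_mulVec m hr, sum_lt_fin_three, show coordMass m (.inr i) = m i from rfl,
    one_div, inv_mul_eq_iff_eq_mul₀ (h i)]
  simp only [pairForm_apply, Fin.sum_univ_three, distAt]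
  fin_cases i <;> simp <;> ring

/-! ### Reduction to isotropic coordinates. -/

/-- The equations, in isotropic coordinates `z = x + e y`, `w = x - e y` with `e² = -1`, of a
Darboux point with multiplier `-1`, mutual distances `R`, and an eigenvector `(a, e a)` of `W`
for the eigenvalue `μ / 2`. -/
structure DecoupledData (m : Fin 3 → ℝ) (z w : Fin 3 → ℂ) (R : Fin 3 → Fin 3 → ℂ)
    (a : Fin 3 → ℂ) (μ : ℂ) : Prop where
  symm : ∀ i j, R i j = R j i
  sq : ∀ i j, i ≠ j → R i j ^ 2 = (z i - z j) * (w i - w j)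
  ne_zero : ∀ i j, i ≠ j → R i j ≠ 0
  central_z : ∀ i, ∑ j, (m j : ℂ) * (z i - z j) / R i j ^ 3 = z i
  central_w : ∀ i, ∑ j, (m j : ℂ) * (w i - w j) / R i j ^ 3 = w i
  norm_ne_zero : ∑ i, (m i : ℂ) * (z i * w i) ≠ 0
  isotropic : ∀ i, ∑ j, (m j : ℂ) * (a i - a j) * (z i - z j) ^ 2 / R i j ^ 5 = 0
  eigen : ∀ i, ∑ j, (m j : ℂ) * (a i - a j) / R i j ^ 3 = μ * a i
  nonconst : ∃ i j, a i ≠ a j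

lemma distAt_symm {n : ℕ} (r : Fin n → Fin n → Config n → ℂ) (c : Config n) (i j : Fin n) :
    distAt r c i j = distAt r c j i := by
  unfold distAt
  rcases lt_trichotomy i j with h | h | h
  · simp [h, h.not_gt]
  · simp [h]
  · simp [h, h.not_gt]

lemma sqDist_symm {n : ℕ} (i j : Fin n) (q : Config n) : sqDist i j q = sqDist j i q := by
  unfold sqDist; ring

lemma distAt_sq {n : ℕ} {r : Fin n → Fin n → Config n → ℂ} {c : Config n}
    (hr : IsDistanceBranch r c) {i j : Fin n} (hij : i ≠ j) :
    distAt r c i j ^ 2 = sqDist i j c ∧ sqDist i j c ≠ 0 := by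
  unfold distAt
  rcases lt_or_gt_of_ne hij with h | h
  · rw [if_neg h.not_gt, sqDist_symm]
    exact ⟨(hr j i h).2.2.self_of_nhds, (hr j i h).1⟩
  · rw [if_pos h]
    exact ⟨(hr i j h).2.2.self_of_nhds, (hr i j h).1⟩

lemma isDarbouxPoint_iff {m : Fin 3 → ℝ} (hm : ∀ i, 0 < m i)
    {r : Fin 3 → Fin 3 → Config 3 → ℂ} {c : Config 3} (hr : IsDistanceBranch r c) :
    IsDarbouxPoint m (potential m r) c (-1) ↔
      (∀ i, ∑ j, (m j : ℂ) * (c (.inl i) - c (.inl j)) / distAt r c i j ^ 3 = c (.inl i)) ∧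
      (∀ i, ∑ j, (m j : ℂ) * (c (.inr i) - c (.inr j)) / distAt r c i j ^ 3 = c (.inr i)) := by
  have h (i) : (m i : ℂ) ≠ 0 := by exact_mod_cast (hm i).ne'
  unfold IsDarbouxPoint
  rw [Sum.forall]
  simp only [partialDeriv_inl m hr, partialDeriv_inr m hr, coordMass, Sum.elim_inl, Sum.elim_inr,
    neg_mul, one_mul, neg_inj, mul_right_inj' (h _)]

/-- The isotropic eigenvector equation in the coordinates `x`, `y`, and in the coordinates
`x + e y`, `x - e y`. -/
lemma hessianMatrix_mulVec_isotropic_iff {m : Fin 3 → ℝ} (hm : ∀ i, 0 < m i)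
    {r : Fin 3 → Fin 3 → Config 3 → ℂ} {c : Config 3} (hr : IsDistanceBranch r c)
    {e : ℂ} (he : e ^ 2 = -1) (a : Fin 3 → ℂ) (μ : ℂ) :
    (hessianMatrix m (potential m r) c).mulVec (Sum.elim a (e • a)) = μ • Sum.elim a (e • a) ↔
      (∀ i, ∑ j, (m j : ℂ) * (a i - a j) * ((c (.inl i) + e * c (.inr i)) -
        (c (.inl j) + e * c (.inr j))) ^ 2 / distAt r c i j ^ 5 = 0) ∧
      (∀ i, ∑ j, (m j : ℂ) * (a i - a j) / distAt r c i j ^ 3 = 2 * μ * a i) := by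
  set X : Fin 3 → ℂ := fun i => (hessianMatrix m (potential m r) c).mulVec
    (Sum.elim a (e • a)) (.inl i) with hX
  set Y : Fin 3 → ℂ := fun i => (hessianMatrix m (potential m r) c).mulVec
    (Sum.elim a (e • a)) (.inr i) with hY
  -- On (a, e a) the polar form at `c` is (a_i - a_j) z_ij, and the 1/r³ terms cancel because 1 + e²
  -- = 0.
  have hz (i) : X i + e * Y i = 3 * ∑ j, (m j : ℂ) * (a i - a j) * ((c (.inl i) + e * c (.inr i)) -
        (c (.inl j) + e * c (.inr j))) ^ 2 / distAt r c i j ^ 5 := by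
    simp only [hX, hY, hessianMatrix_mulVec_inl hm hr, hessianMatrix_mulVec_inr hm hr,
      pairForm_apply, Finset.mul_sum, ← Finset.sum_add_distrib]
    refine Finset.sum_congr rfl fun j _ => ?_
    simp
    linear_combination -(m j : ℂ) * (a i - a j) / distAt r c i j ^ 3 * he
  -- Here z_ij w_ij = r², so the two kinds of terms combine as 3/r³ - 2/r³.
  have hw (i) : X i - e * Y i = ∑ j, (m j : ℂ) * (a i - a j) / distAt r c i j ^ 3 := by
    simp only [hX, hY, hessianMatrix_mulVec_inl hm hr, hessianMatrix_mulVec_inr hm hr,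
      pairForm_apply, Finset.mul_sum, ← Finset.sum_sub_distrib]
    refine Finset.sum_congr rfl fun j _ => ?_
    rcases eq_or_ne i j with rfl | hij
    · simp
    obtain ⟨h1, h2⟩ := distAt_sq hr hij
    have h3 : distAt r c i j ≠ 0 := fun h => h2 (by rw [← h1, h]; simp)
    unfold sqDist at h1
    simp
    field_simp
    linear_combination (m j : ℂ) * (a i - a j) *
      ((distAt r c i j ^ 2 - 3 * (c (.inr i) - c (.inr j)) ^ 2) * he - 3 * h1)
  have key : (hessianMatrix m (potential m r) c).mulVec (Sum.elim a (e • a)) =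
      μ • Sum.elim a (e • a) ↔ ∀ i, X i = μ * a i ∧ Y i = μ * (e * a i) := by
    rw [funext_iff, Sum.forall, ← forall_and]
    simp [hX, hY]
  rw [key, ← forall_and]
  refine forall_congr' fun i => ?_
  rw [← hw]
  have h3 := hz i
  constructor
  · rintro ⟨h1, h2⟩
    refine ⟨?_, ?_⟩
    · linear_combination (-h3 + h1 + e * h2 + μ * a i * he) / 3
    · linear_combination h1 - e * h2 - μ * a i * he
  · rintro ⟨h1, h2⟩
    refine ⟨?_, ?_⟩
    · linear_combination (h3 + 3 * h1 + h2) / 2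
    · linear_combination -e * (h3 + 3 * h1 - h2) / 2 + Y i * he

lemma rotation_mulVec {n : ℕ} (θ : ℂ) (v : Config n) :
    (rotation n θ).mulVec v = Sum.elim
      (fun i => Complex.cos θ * v (.inl i) - Complex.sin θ * v (.inr i))
      (fun i => Complex.sin θ * v (.inl i) + Complex.cos θ * v (.inr i)) := by
  unfold rotation
  rw [Matrix.fromBlocks_mulVec]
  ext i
  rcases i with i | i <;> simp [Matrix.smul_mulVec, Matrix.neg_mulVec, sub_eq_add_neg]

/-- With J the quarter turn, v + e J v is an isotropic vector of the stable space, with a = v_x - e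
v_y. If a is constant for both e = ±i, then v is a translation. Conversely, an isotropic vector
spans a rotation-stable line, with factor cos θ - e sin θ. -/
lemma isPartiallyDecoupled_iff {n : ℕ} [NeZero n] (m : Fin n → ℝ) (V : Config n → ℂ) (c : Config n) :
    IsPartiallyDecoupled m V c ↔ ∃ (e : ℂ) (a : Fin n → ℂ) (μ : ℂ), e ^ 2 = -1 ∧
      (∃ i j, a i ≠ a j) ∧
      (hessianMatrix m V c).mulVec (Sum.elim a (e • a)) = μ • Sum.elim a (e • a) := by
  constructor
  · rintro ⟨U, μ, hU, hW, hR⟩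
    by_contra! H
    refine hU fun v hv => ?_
    have hJ := hR (Real.pi / 2 : ℂ) v hv
    rw [rotation_mulVec] at hJ
    have key (e : ℂ) (he : e ^ 2 = -1) (i j : Fin n) :
        v (.inl i) - e * v (.inr i) = v (.inl j) - e * v (.inr j) := by
      by_contra hne
      refine H e (fun i => v (.inl i) - e * v (.inr i)) μ he ⟨i, j, hne⟩ (hW _ ?_)
      convert U.add_mem hv (U.smul_mem e hJ) using 1
      ext k
      rcases k with k | k
      · simp; ring
      · simp
        linear_combination -v (.inr k) * he
    have h1 := key Complex.I (by simp)
    have h2 := key (-Complex.I) (by simp)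
    rw [translations, Submodule.mem_span_pair]
    refine ⟨v (.inl 0), v (.inr 0), ?_⟩
    ext k
    rcases k with k | k
    · simp
      linear_combination (h1 0 k + h2 0 k) / 2
    · simp
      linear_combination Complex.I * (h1 0 k - h2 0 k) / 2 +
        (v (.inr 0) - v (.inr k)) * Complex.I_sq
  · rintro ⟨e, a, μ, he, ⟨i, j, hij⟩, h⟩
    refine ⟨Submodule.span ℂ {Sum.elim a (e • a)}, μ, ?_, ?_, ?_⟩
    · rw [Submodule.span_singleton_le_iff_mem, translations, Submodule.mem_span_pair]
      rintro ⟨s, t, hst⟩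
      have h1 := congrFun hst (.inl i)
      have h2 := congrFun hst (.inl j)
      simp at h1 h2
      exact hij (h1.symm.trans h2)
    · intro v hv
      obtain ⟨s, rfl⟩ := Submodule.mem_span_singleton.1 hv
      rw [Matrix.mulVec_smul, h, smul_comm]
    · intro θ v hv
      obtain ⟨s, rfl⟩ := Submodule.mem_span_singleton.1 hv
      refine Submodule.mem_span_singleton.2 ⟨s * (Complex.cos θ - e * Complex.sin θ), ?_⟩
      rw [rotation_mulVec]
      ext k
      rcases k with k | k
      · simp; ring
      · simp
        linear_combination -s * Complex.sin θ * a k * he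

lemma massNormSq_eq {n : ℕ} (m : Fin n → ℝ) (c : Config n) {e : ℂ} (he : e ^ 2 = -1) :
    massNormSq m c = ∑ i, (m i : ℂ) *
      ((c (.inl i) + e * c (.inr i)) * (c (.inl i) - e * c (.inr i))) := by
  rw [massNormSq, Fintype.sum_sum_type, ← Finset.sum_add_distrib]
  refine Finset.sum_congr rfl fun i _ => ?_
  simp [coordMass]
  linear_combination (m i : ℂ) * c (.inr i) ^ 2 * he

/-- Normalising the squared distance to 1 at `c` keeps the principal square root away from its cut;
the prescribed value `R i j` carries the choice of sign. -/
lemma exists_isDistanceBranch {n : ℕ} {c : Config n} {R : Fin n → Fin n → ℂ}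
    (hR : ∀ i j, R i j = R j i) (h0 : ∀ i j, i ≠ j → R i j ≠ 0)
    (hsq : ∀ i j, i ≠ j → R i j ^ 2 = sqDist i j c) :
    ∃ r, IsDistanceBranch r c ∧ ∀ i j, i ≠ j → distAt r c i j = R i j := by
  have hval (i j : Fin n) (hij : i ≠ j) : sqDist i j c / sqDist i j c = 1 :=
    div_self (by rw [← hsq i j hij]; exact pow_ne_zero 2 (h0 i j hij))
  refine ⟨fun i j q => R i j * (sqDist i j q / sqDist i j c) ^ (1 / 2 : ℂ), ?_, ?_⟩
  · intro i j hij
    have hS : sqDist i j c ≠ 0 := by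
      rw [← hsq i j hij.ne']; exact pow_ne_zero 2 (h0 i j hij.ne')
    have hp (k : Fin n ⊕ Fin n) : AnalyticAt ℂ (fun q : Config n => q k) c :=
      (ContinuousLinearMap.proj (R := ℂ) (φ := fun _ : Fin n ⊕ Fin n => ℂ) k).analyticAt c
    have hA : AnalyticAt ℂ (sqDist i j) c :=
      (((hp (.inl i)).sub (hp (.inl j))).pow 2).add (((hp (.inr i)).sub (hp (.inr j))).pow 2)
    refine ⟨hS, analyticAt_const.mul ((hA.div_const).cpow analyticAt_const ?_), ?_⟩
    · rw [hval i j hij.ne']; simp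
    · refine Filter.Eventually.of_forall fun q => ?_
      rw [mul_pow, ← Complex.cpow_nat_mul, hsq i j hij.ne']
      simp
      field_simp
  · intro i j hij
    unfold distAt
    split_ifs
    · simp [hval i j hij]
    · simp [hval j i hij.symm, hR j i]

lemma exists_isPartiallyDecoupled_iff {m : Fin 3 → ℝ} (hm : ∀ i, 0 < m i) :
    (∃ (c : Config 3) (r : Fin 3 → Fin 3 → Config 3 → ℂ),
      IsDistanceBranch r c ∧
      IsDarbouxPoint m (potential m r) c (-1) ∧
      massNormSq m c ≠ 0 ∧
      IsPartiallyDecoupled m (potential m r) c) ↔ ∃ z w R a μ, DecoupledData m z w R a μ := by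
  constructor
  · rintro ⟨c, r, hr, hD, hN, hP⟩
    obtain ⟨e, a, μ, he, hne, hW⟩ := (isPartiallyDecoupled_iff _ _ _).1 hP
    rw [hessianMatrix_mulVec_isotropic_iff hm hr he] at hW
    rw [isDarbouxPoint_iff hm hr] at hD
    rw [massNormSq_eq m c he] at hN
    refine ⟨fun i => c (.inl i) + e * c (.inr i), fun i => c (.inl i) - e * c (.inr i),
      distAt r c, a, 2 * μ, distAt_symm r c, ?_, ?_, ?_, ?_, hN, hW.1, hW.2, hne⟩
    · intro i j hij
      rw [(distAt_sq hr hij).1, sqDist]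
      linear_combination (c (.inr i) - c (.inr j)) ^ 2 * he
    · intro i j hij h
      obtain ⟨h1, h2⟩ := distAt_sq hr hij
      exact h2 (by rw [← h1, h]; simp)
    · intro i
      have h1 := hD.1 i
      have h2 := hD.2 i
      simp only [Fin.sum_univ_three] at h1 h2 ⊢
      linear_combination h1 + e * h2
    · intro i
      have h1 := hD.1 i
      have h2 := hD.2 i
      simp only [Fin.sum_univ_three] at h1 h2 ⊢
      linear_combination h1 - e * h2
  · rintro ⟨z, w, R, a, μ, h⟩
    set c : Config 3 := Sum.elim (fun i => (z i + w i) / 2)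
      (fun i => -Complex.I * (z i - w i) / 2) with hc
    have hz (i) : c (.inl i) + Complex.I * c (.inr i) = z i := by
      simp [hc]; linear_combination -(z i - w i) / 2 * Complex.I_sq
    have hw (i) : c (.inl i) - Complex.I * c (.inr i) = w i := by
      simp [hc]; linear_combination (z i - w i) / 2 * Complex.I_sq
    obtain ⟨r, hr, hrR⟩ := exists_isDistanceBranch (c := c) h.symm h.ne_zero fun i j hij => by
      rw [h.sq i j hij, sqDist, ← hz i, ← hz j, ← hw i, ← hw j]
      linear_combination -(c (.inr i) - c (.inr j)) ^ 2 * Complex.I_sq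
    have hsum (f : Fin 3 → Fin 3 → ℂ) (hf : ∀ i, f i i = 0) (k : ℕ) (i : Fin 3) :
        ∑ j, (m j : ℂ) * f i j / distAt r c i j ^ k = ∑ j, (m j : ℂ) * f i j / R i j ^ k := by
      refine Finset.sum_congr rfl fun j _ => ?_
      rcases eq_or_ne i j with rfl | hij
      · simp [hf]
      · rw [hrR i j hij]
    refine ⟨c, r, hr, ?_, ?_, ?_⟩
    · rw [isDarbouxPoint_iff hm hr]
      simp only [fun (i : Fin 3) => hsum (fun i j => c (.inl i) - c (.inl j)) (by simp) 3 i,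
        fun (i : Fin 3) => hsum (fun i j => c (.inr i) - c (.inr j)) (by simp) 3 i]
      refine ⟨fun i => ?_, fun i => ?_⟩
      · have h1 := h.central_z i
        have h2 := h.central_w i
        simp only [Fin.sum_univ_three, hc, Sum.elim_inl] at h1 h2 ⊢
        linear_combination (h1 + h2) / 2
      · have h1 := h.central_z i
        have h2 := h.central_w i
        simp only [Fin.sum_univ_three, hc, Sum.elim_inr] at h1 h2 ⊢
        linear_combination -Complex.I * (h1 - h2) / 2
    · rw [massNormSq_eq m c Complex.I_sq]
      simpa only [hz, hw] using h.norm_ne_zero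
    · refine (isPartiallyDecoupled_iff _ _ _).2 ⟨Complex.I, a, μ / 2, Complex.I_sq, h.nonconst, ?_⟩
      rw [hessianMatrix_mulVec_isotropic_iff hm hr Complex.I_sq]
      simp only [hz]
      refine ⟨fun i => ?_, fun i => ?_⟩
      · simp only [mul_assoc]
        rw [hsum (fun i j => (a i - a j) * (z i - z j) ^ 2) (by simp) 5 i, ← h.isotropic i]
        simp only [mul_assoc]
      · rw [hsum (fun i j => a i - a j) (by simp) 3 i, h.eigen i]
        ring

/-! ### Real masses from nonreal ratios. -/

lemma eq_zero_of_add_mul_eq_zero {x : ℂ} (hx : x.im ≠ 0) {a b : ℝ} (h : (a : ℂ) + b * x = 0) :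
    a = 0 ∧ b = 0 := by
  have h1 := congrArg Complex.im h
  have h2 := congrArg Complex.re h
  simp at h1 h2
  have hb : b = 0 := h1.resolve_right hx
  exact ⟨by simpa [hb] using h2, hb⟩

lemma masses_eq_of_equilateral {n₀ n₁ n₂ : ℝ} {p q : ℂ} (hp : p ≠ 0)
    (h : p ^ 2 + p * q + q ^ 2 = 0) (hn : n₂ * p ^ 2 + n₀ * q ^ 2 + n₁ * (p + q) ^ 2 = 0) :
    n₀ = n₂ ∧ n₁ = n₂ := by
  obtain ⟨x, rfl⟩ : ∃ x, q = x * p := ⟨q / p, by field_simp⟩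
  have hx : 1 + x + x ^ 2 = 0 := by
    refine (mul_eq_zero.1 (?_ : p ^ 2 * (1 + x + x ^ 2) = 0)).resolve_left (pow_ne_zero 2 hp)
    linear_combination h
  have him : x.im ≠ 0 := by
    intro him
    have h1 := congrArg Complex.re hx
    simp [pow_two, him] at h1
    nlinarith [sq_nonneg (x.re + 1 / 2)]
  have hlin : ((n₂ - n₀ : ℝ) : ℂ) + (n₁ - n₀ : ℝ) * x = 0 := by
    refine (mul_eq_zero.1 (?_ : p ^ 2 * (((n₂ - n₀ : ℝ) : ℂ) + (n₁ - n₀ : ℝ) * x) = 0)).resolve_left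
      (pow_ne_zero 2 hp)
    push_cast
    linear_combination hn - p ^ 2 * (n₀ + n₁) * hx
  obtain ⟨h1, h2⟩ := eq_zero_of_add_mul_eq_zero him hlin
  exact ⟨by linarith, by linarith⟩

lemma eq_of_quadratic_relations {n₀ n₁ n₂ : ℝ} (hs : n₀ + n₁ + n₂ = 1)
    (h1 : n₁ * (n₀ + n₂) = 5 * (n₀ * n₂)) (h2 : n₀ ^ 2 + n₁ ^ 2 + n₂ ^ 2 = 9 * (n₀ * n₂)) :
    n₁ = 1 / 2 - √21 / 42 ∧
      (n₀ = 1 / 4 + (√21 + √(126 + 42 * √21)) / 84 ∧ n₂ = 1 / 4 + (√21 - √(126 + 42 * √21)) / 84 ∨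
       n₂ = 1 / 4 + (√21 + √(126 + 42 * √21)) / 84 ∧
         n₀ = 1 / 4 + (√21 - √(126 + 42 * √21)) / 84) := by
  have h21 : √21 ^ 2 = 21 := Real.sq_sqrt (by norm_num)
  have hpos : 0 ≤ √21 := Real.sqrt_nonneg _
  have hT : √(126 + 42 * √21) ^ 2 = 126 + 42 * √21 := Real.sq_sqrt (by positivity)
  generalize √(126 + 42 * √21) = T at *
  generalize √21 = s at *
  obtain rfl : n₂ = 1 - n₀ - n₁ := by linarith
  have hq : 21 * n₁ ^ 2 - 21 * n₁ + 5 = 0 := by linear_combination -11 * h1 + 5 * h2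
  have hn : (n₁ - (1 / 2 - s / 42)) * (n₁ - (1 / 2 + s / 42)) = 0 := by
    linear_combination hq / 21 - h21 / 42 ^ 2
  have hn1 : n₁ = 1 / 2 - s / 42 := by
    -- The larger root would make (n₀ - n₂)² negative.
    rcases mul_eq_zero.1 hn with h | h
    · linarith
    · obtain rfl : n₁ = 1 / 2 + s / 42 := by linarith
      nlinarith [sq_nonneg (n₀ - (1 - n₀ - (1 / 2 + s / 42)))]
  subst hn1
  refine ⟨rfl, ?_⟩
  have hd : (n₀ - (1 / 4 + (s + T) / 84)) * (n₀ - (1 / 4 + (s - T) / 84)) = 0 := by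
    linear_combination 1 / 5 * h1 - hT / 84 ^ 2 + h21 * (1 / 84 ^ 2 + 1 / (5 * 42 ^ 2))
  rcases mul_eq_zero.1 hd with h | h
  · left; constructor <;> linarith
  · right; constructor <;> linarith

/-- The quartic and the real quadratic share the nonreal root x, so the remainder of the division of
one by the other vanishes. The quartic is palindromic, which produces the factor 1 - b below. -/
lemma quadratic_relations_of_root {n₀ n₁ n₂ : ℝ} (h0 : 0 < n₀)
    {x : ℂ} (hx : x ^ 4 + 5 * x ^ 3 + 9 * x ^ 2 + 5 * x + 1 = 0)
    (hn : n₂ + n₁ * x + n₀ * x ^ 2 = 0) :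
    n₁ * (n₀ + n₂) = 5 * (n₀ * n₂) ∧ n₀ ^ 2 + n₁ ^ 2 + n₂ ^ 2 = 9 * (n₀ * n₂) := by
  have him : x.im ≠ 0 := by
    intro him
    obtain ⟨y, rfl⟩ : ∃ y : ℝ, x = y := ⟨x.re, by apply Complex.ext <;> simp [him]⟩
    have h1 : y ^ 4 + 5 * y ^ 3 + 9 * y ^ 2 + 5 * y + 1 = 0 := by exact_mod_cast hx
    -- A sum of squares shows that the quartic has no real root.
    have h2 : ((1 + y) ^ 2 + y / 2) ^ 2 + 3 / 4 * y ^ 2 = 0 := by linear_combination h1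
    have h3 : y = 0 := by nlinarith [sq_nonneg ((1 + y) ^ 2 + y / 2)]
    norm_num [h3] at h1
  obtain ⟨a, rfl⟩ : ∃ a, n₁ = a * n₀ := ⟨n₁ / n₀, by field_simp⟩
  obtain ⟨b, rfl⟩ : ∃ b, n₂ = b * n₀ := ⟨n₂ / n₀, by field_simp⟩
  have hq : x ^ 2 + a * x + b = 0 := by
    refine (mul_eq_zero.1 (?_ : (n₀ : ℂ) * (x ^ 2 + a * x + b) = 0)).resolve_left
      (by exact_mod_cast h0.ne')
    push_cast at hn
    linear_combination hn
  have hrem : ((1 - b * (9 - b - 5 * a + a ^ 2) : ℝ) : ℂ) +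
      (5 - a * (9 - b - 5 * a + a ^ 2) - b * (5 - a) : ℝ) * x = 0 := by
    push_cast
    linear_combination hx - (x ^ 2 + (5 - a) * x + (9 - b - 5 * a + a ^ 2)) * hq
  obtain ⟨h1, h2⟩ := eq_zero_of_add_mul_eq_zero him hrem
  have h3 : (1 - b) * (a * (1 + b) - 5 * b) = 0 := by linear_combination -b * h2 + a * h1
  have h4 : a * (1 + b) = 5 * b := by
    -- For b = 1 the remainder gives a² - 5a + 7 = 0, which has no real solution.
    rcases mul_eq_zero.1 h3 with h | h
    · obtain rfl : b = 1 := by linarith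
      nlinarith [sq_nonneg (a - 5 / 2)]
    · linarith
  have h5 : 1 + a ^ 2 + b ^ 2 = 9 * b := by linear_combination h1 + a * h4
  exact ⟨by linear_combination n₀ ^ 2 * h4, by linear_combination n₀ ^ 2 * h5⟩

/-- The ratio x = q/p satisfies (1 + x)² = η x with η a primitive cube root of unity; eliminating η
gives the palindromic quartic. -/
lemma masses_eq_of_lagrange {n₀ n₁ n₂ : ℝ} (h0 : 0 < n₀) (hs : n₀ + n₁ + n₂ = 1) {p q η : ℂ}
    (hp : p ≠ 0) (hη : η ^ 2 + η + 1 = 0) (h : (p + q) ^ 2 = η * (p * q))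
    (hn : n₂ * p ^ 2 + n₀ * q ^ 2 + n₁ * (p * q) = 0) :
    n₁ = 1 / 2 - √21 / 42 ∧
      (n₀ = 1 / 4 + (√21 + √(126 + 42 * √21)) / 84 ∧ n₂ = 1 / 4 + (√21 - √(126 + 42 * √21)) / 84 ∨
       n₂ = 1 / 4 + (√21 + √(126 + 42 * √21)) / 84 ∧
         n₀ = 1 / 4 + (√21 - √(126 + 42 * √21)) / 84) := by
  obtain ⟨x, rfl⟩ : ∃ x, q = x * p := ⟨q / p, by field_simp⟩
  have hx : (1 + x) ^ 2 = η * x := by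
    refine mul_left_cancel₀ (pow_ne_zero 2 hp) ?_
    linear_combination h
  have hn' : n₂ + n₁ * x + n₀ * x ^ 2 = 0 := by
    refine (mul_eq_zero.1 (?_ : p ^ 2 * (n₂ + n₁ * x + n₀ * x ^ 2) = 0)).resolve_left
      (pow_ne_zero 2 hp)
    linear_combination hn
  obtain ⟨h1, h2⟩ := quadratic_relations_of_root h0 (x := x)
    (by linear_combination ((1 + x) ^ 2 + η * x + x) * hx + x ^ 2 * hη) hn'
  exact eq_of_quadratic_relations hs h1 h2

lemma masses_eq_of_collinear {n₀ n₁ n₂ : ℝ} (hs : n₀ + n₁ + n₂ = 1) {p q : ℂ}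
    (hp : p ≠ 0) (h : 2 * p ^ 2 + 3 * (p * q) + 2 * q ^ 2 = 0)
    (hn : n₂ * p ^ 3 + n₀ * q ^ 3 + n₁ * (p + q) ^ 3 = 0) :
    n₀ = 1 / 7 ∧ n₁ = 5 / 7 ∧ n₂ = 1 / 7 := by
  obtain ⟨x, rfl⟩ : ∃ x, q = x * p := ⟨q / p, by field_simp⟩
  have hx : 2 + 3 * x + 2 * x ^ 2 = 0 := by
    refine (mul_eq_zero.1 (?_ : p ^ 2 * (2 + 3 * x + 2 * x ^ 2) = 0)).resolve_left
      (pow_ne_zero 2 hp)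
    linear_combination h
  have him : x.im ≠ 0 := by
    intro him
    have h1 := congrArg Complex.re hx
    simp [pow_two, him] at h1
    nlinarith [sq_nonneg (x.re + 3 / 4)]
  have hlin : ((6 * n₀ - 2 * n₁ + 4 * n₂ : ℝ) : ℂ) + (5 * n₀ - n₁ : ℝ) * x = 0 := by
    refine (mul_eq_zero.1 (?_ : p ^ 3 * (((6 * n₀ - 2 * n₁ + 4 * n₂ : ℝ) : ℂ) +
      (5 * n₀ - n₁ : ℝ) * x) = 0)).resolve_left (pow_ne_zero 3 hp)
    push_cast
    linear_combination 4 * hn - p ^ 3 * (n₀ * (2 * x - 3) + n₁ * (2 * x + 3)) * hx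
  obtain ⟨h1, h2⟩ := eq_zero_of_add_mul_eq_zero him hlin
  exact ⟨by linarith, by linarith, by linarith⟩

lemma exists_perm_comp_eq (m : Fin 3 → ℝ) (i j k : Fin 3) (hij : i ≠ j) (hjk : j ≠ k) (hik : i ≠ k)
    {a b c : ℝ} (hi : m i = a) (hj : m j = b) (hk : m k = c) :
    ∃ σ : Equiv.Perm (Fin 3), m ∘ σ = ![a, b, c] := by
  have h : ∀ i j k : Fin 3, i ≠ j → j ≠ k → i ≠ k →
      ∃ σ : Equiv.Perm (Fin 3), σ 0 = i ∧ σ 1 = j ∧ σ 2 = k := by decide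
  obtain ⟨σ, h0, h1, h2⟩ := h i j k hij hjk hik
  refine ⟨σ, ?_⟩
  ext l
  fin_cases l <;> simp [*]

/-- The masses of the theorem, up to a permutation. -/
def IsExceptional (m : Fin 3 → ℝ) : Prop :=
  ∃ σ : Equiv.Perm (Fin 3),
      m ∘ σ = ![1 / 3, 1 / 3, 1 / 3] ∨
      m ∘ σ = ![1 / 7, 5 / 7, 1 / 7] ∨
      m ∘ σ = ![1 / 4 + (√21 + √(126 + 42 * √21)) / 84,
                1 / 2 - √21 / 42,
                1 / 4 + (√21 - √(126 + 42 * √21)) / 84]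

lemma isExceptional_of_equilateral {m : Fin 3 → ℝ} (h0 : m 0 = 1 / 3) (h1 : m 1 = 1 / 3)
    (h2 : m 2 = 1 / 3) : IsExceptional m :=
  (exists_perm_comp_eq m 0 1 2 (by decide) (by decide) (by decide) h0 h1 h2).imp
    fun _ => Or.inl

lemma isExceptional_of_collinear {m : Fin 3 → ℝ} {i j k : Fin 3} (hij : i ≠ j) (hjk : j ≠ k)
    (hik : i ≠ k) (h : m i = 1 / 7 ∧ m j = 5 / 7 ∧ m k = 1 / 7) : IsExceptional m :=
  (exists_perm_comp_eq m i j k hij hjk hik h.1 h.2.1 h.2.2).imp fun _ h => Or.inr (Or.inl h)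

lemma isExceptional_of_lagrange {m : Fin 3 → ℝ} {i j k : Fin 3} (hij : i ≠ j) (hjk : j ≠ k)
    (hik : i ≠ k) (h : m j = 1 / 2 - √21 / 42 ∧
      (m i = 1 / 4 + (√21 + √(126 + 42 * √21)) / 84 ∧ m k = 1 / 4 + (√21 - √(126 + 42 * √21)) / 84 ∨
       m k = 1 / 4 + (√21 + √(126 + 42 * √21)) / 84 ∧
         m i = 1 / 4 + (√21 - √(126 + 42 * √21)) / 84)) : IsExceptional m := by
  obtain ⟨hj, ⟨hi, hk⟩ | ⟨hk, hi⟩⟩ := h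
  · exact (exists_perm_comp_eq m i j k hij hjk hik hi hj hk).imp fun _ h => Or.inr (Or.inr h)
  · exact (exists_perm_comp_eq m k j i hjk.symm hij.symm hik.symm hk hj hi).imp
      fun _ h => Or.inr (Or.inr h)

/-! ### The Lagrange and the collinear case. -/

/-- Up to a common factor the distances are 1, α, β with α³ = β³ = 1. All equal gives equal masses.
Exactly two equal gives `masses_eq_of_lagrange`, the middle mass being opposite to the odd side.
Three distinct values are impossible: the closing relation then has the double root q = α p, at
which the mass relation reads p² (m₀ + m₁ + m₂) = 0. -/
lemma isExceptional_of_cube_eq_one {m : Fin 3 → ℝ} (hm : ∀ i, 0 < m i) (hsum : m 0 + m 1 + m 2 = 1)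
    {p q t r₁ r₂ r₃ : ℂ} (hp : p ≠ 0) (hq : q ≠ 0) (ht : t ≠ 0) (hpqt : p + q + t = 0)
    (h₁ : r₁ ^ 3 = 1) (h₂ : r₂ ^ 3 = 1) (h₃ : r₃ ^ 3 = 1)
    (hr : r₃ ^ 2 / p + r₁ ^ 2 / q + r₂ ^ 2 / t = 0)
    (hA : m 2 * (r₃ * p ^ 2) + m 0 * (r₁ * q ^ 2) + m 1 * (r₂ * t ^ 2) = 0) :
    IsExceptional m := by
  have h3 : r₃ ≠ 0 := by rintro rfl; norm_num at h₃
  have h1 : r₁ ≠ 0 := by rintro rfl; norm_num at h₁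
  have h2 : r₂ ≠ 0 := by rintro rfl; norm_num at h₂
  have hsum' : (m 0 : ℂ) + m 1 + m 2 = 1 := by exact_mod_cast hsum
  obtain ⟨α, rfl⟩ : ∃ α, r₁ = α * r₃ := ⟨r₁ / r₃, by field_simp⟩
  obtain ⟨β, rfl⟩ : ∃ β, r₂ = β * r₃ := ⟨r₂ / r₃, by field_simp⟩
  replace h₁ : α ^ 3 = 1 := by rw [mul_pow, h₃] at h₁; simpa using h₁
  replace h₂ : β ^ 3 = 1 := by rw [mul_pow, h₃] at h₂; simpa using h₂
  replace hA : m 2 * p ^ 2 + m 0 * (α * q ^ 2) + m 1 * (β * t ^ 2) = 0 := by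
    refine (mul_eq_zero.1 (?_ : r₃ * _ = 0)).resolve_left h3
    linear_combination hA
  replace hr : q * t + α ^ 2 * (p * t) + β ^ 2 * (p * q) = 0 := by
    refine (mul_eq_zero.1 (?_ : r₃ ^ 2 * _ = 0)).resolve_left (pow_ne_zero 2 h3)
    field_simp at hr
    linear_combination hr
  have hroot {x : ℂ} (hx : x ^ 3 = 1) (hx1 : x ≠ 1) : x ^ 2 + x + 1 = 0 := by
    refine (mul_eq_zero.1 (?_ : (x - 1) * _ = 0)).resolve_left (sub_ne_zero.2 hx1)
    linear_combination hx
  obtain rfl : t = -(p + q) := by linear_combination hpqt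
  by_cases hα : α = 1
  · subst hα
    by_cases hβ : β = 1
    · subst hβ
      obtain ⟨h4, h5⟩ := masses_eq_of_equilateral (n₀ := m 0) (n₁ := m 1) (n₂ := m 2) hp
        (q := q) (by linear_combination -hr) (by linear_combination hA)
      exact isExceptional_of_equilateral (by linarith) (by linarith) (by linarith)
    · have hβ' := hroot h₂ hβ
      refine isExceptional_of_lagrange (i := 0) (j := 1) (k := 2) (by decide) (by decide)
        (by decide) (masses_eq_of_lagrange (hm 0) hsum (p := p) (q := q) (η := β ^ 2) hp ?_ ?_ ?_)
      · linear_combination (β ^ 2 - β + 1) * hβ'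
      · linear_combination -hr
      · linear_combination hA + m 1 * β * hr - m 1 * p * q * h₂
  · have hα' := hroot h₁ hα
    by_cases hβ : β = 1
    · subst hβ
      refine isExceptional_of_lagrange (i := 1) (j := 0) (k := 2) (by decide) (by decide)
        (by decide) (masses_eq_of_lagrange (hm 1) (by linarith) (p := p) (q := -(p + q))
          (η := α ^ 2) hp ?_ ?_ ?_)
      · linear_combination (α ^ 2 - α + 1) * hα'
      · linear_combination -hr
      · linear_combination hA + m 0 * α * hr + m 0 * p * (p + q) * h₁
    · by_cases hαβ : β = α
      · subst hαβ
        refine isExceptional_of_lagrange (i := 0) (j := 2) (k := 1) (by decide) (by decide)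
          (by decide) (masses_eq_of_lagrange (n₂ := m 1) (hm 0) (by linarith) (p := -(p + q))
            (q := q) (η := β) ht hα' ?_ ?_)
        · linear_combination -β * hr - p ^ 2 * h₁
        · linear_combination β ^ 2 * hA + m 2 * hr - (m 0 * q ^ 2 + m 1 * (p + q) ^ 2) * h₁
      · have hβα : β = α ^ 2 := by
          have h4 := hroot h₂ hβ
          have : (β - α) * (β - α ^ 2) = 0 := by linear_combination h4 - (β - α + 1) * hα'
          rcases mul_eq_zero.1 this with h | h
          · exact absurd (sub_eq_zero.1 h) hαβ
          · exact sub_eq_zero.1 h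
        subst hβα
        have h5 : (α * p - q) ^ 2 = 0 := by
          linear_combination -hr + p * q * (α ^ 2 - α - 1) * hα'
        have h6 : q = α * p := by
          have := pow_eq_zero_iff (two_ne_zero) |>.1 h5
          linear_combination -this
        subst h6
        exfalso
        refine mul_ne_zero (pow_ne_zero 2 hp) (one_ne_zero (α := ℂ)) ?_
        linear_combination hA - p ^ 2 * hsum' - p ^ 2 * m 0 * h₁ + p ^ 2 * m 1 * (1 - α - α ^ 2) * hα'

lemma isExceptional_of_pow_four_add {m : Fin 3 → ℝ} {i j k : Fin 3} (hij : i ≠ j) (hjk : j ≠ k)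
    (hik : i ≠ k) (hs : m i + m j + m k = 1) {p q : ℂ} (hp : p ≠ 0) (hq : q ≠ 0)
    (h : p ^ 4 + q ^ 4 = (p + q) ^ 4)
    (hn : m k * p ^ 3 + m i * q ^ 3 + m j * (p + q) ^ 3 = 0) : IsExceptional m := by
  refine isExceptional_of_collinear hij hjk hik (masses_eq_of_collinear hs hp ?_ hn)
  refine (mul_eq_zero.1 (?_ : (p * q) * _ = 0)).resolve_left (mul_ne_zero hp hq)
  linear_combination -h / 2

/-- Comparing the two expressions for p q gives d₁ q⁴ + d₂ t⁴ + d₃ p⁴ = 0. If the signs agree, the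
left side is ±2 (p² + p q + q²)², and its vanishing forces p = 0. Otherwise one sign is odd, and the
body opposite to that side is the heavy one. -/
lemma isExceptional_of_signs {m : Fin 3 → ℝ} (hs : m 0 + m 1 + m 2 = 1)
    {p q t K d₁ d₂ d₃ : ℂ} (hp : p ≠ 0) (hq : q ≠ 0) (ht : t ≠ 0) (hpqt : p + q + t = 0)
    (h₁ : d₁ = 1 ∨ d₁ = -1) (h₂ : d₂ = 1 ∨ d₂ = -1) (h₃ : d₃ = 1 ∨ d₃ = -1)
    (hpK : p = K * (d₁ * q ^ 3 - d₂ * t ^ 3)) (hqK : q = K * (d₂ * t ^ 3 - d₃ * p ^ 3))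
    (hn : m 2 * (d₃ * p ^ 3) + m 0 * (d₁ * q ^ 3) + m 1 * (d₂ * t ^ 3) = 0) :
    IsExceptional m := by
  have hK : K ≠ 0 := by rintro rfl; simp at hpK; exact hp hpK
  obtain rfl : t = -(p + q) := by linear_combination hpqt
  have h4 : d₁ * q ^ 4 + d₂ * (p + q) ^ 4 + d₃ * p ^ 4 = 0 := by
    refine (mul_eq_zero.1 (?_ : K * _ = 0)).resolve_left hK
    linear_combination p * hqK - q * hpK
  have same (h : q ^ 4 + (p + q) ^ 4 + p ^ 4 = 0)
      (hd : p = K * (d₁ * (q ^ 3 + (p + q) ^ 3))) : False := by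
    have h5 : p ^ 2 + p * q + q ^ 2 = 0 :=
      (pow_eq_zero_iff two_ne_zero).1 (by linear_combination h / 2)
    apply hp
    rw [hd]
    linear_combination K * d₁ * (p + 2 * q) * h5
  have h01 : (0 : Fin 3) ≠ 1 := by decide
  have h12 : (1 : Fin 3) ≠ 2 := by decide
  have h02 : (0 : Fin 3) ≠ 2 := by decide
  rcases h₁ with rfl | rfl <;> rcases h₂ with rfl | rfl <;> rcases h₃ with rfl | rfl
  · exact (same (by linear_combination h4) (by linear_combination hpK)).elim
  · refine isExceptional_of_pow_four_add (p := -(p + q)) (q := q) h02 h12.symm h01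
      (by linarith) ht hq (by linear_combination h4) (by linear_combination hn)
  · refine isExceptional_of_pow_four_add (p := p) (q := q) h01 h12 h02 (by linarith) hp hq
      (by linear_combination h4) (by linear_combination hn)
  · refine isExceptional_of_pow_four_add (p := p) (q := -(p + q)) h01.symm h02 h12 (by linarith)
      hp ht (by linear_combination -h4) (by linear_combination -hn)
  · refine isExceptional_of_pow_four_add (p := p) (q := -(p + q)) h01.symm h02 h12 (by linarith)
      hp ht (by linear_combination h4) (by linear_combination hn)
  · refine isExceptional_of_pow_four_add (p := p) (q := q) h01 h12 h02 (by linarith) hp hq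
      (by linear_combination -h4) (by linear_combination -hn)
  · refine isExceptional_of_pow_four_add (p := -(p + q)) (q := q) h02 h12.symm h01
      (by linarith) ht hq (by linear_combination -h4)
      (by linear_combination -hn)
  · exact (same (by linear_combination -h4) (by linear_combination hpK)).elim

/-- A 2 × 2 matrix fixing two independent vectors is the identity; its entries off the diagonal are
μ₂ (s₂ - s₁) and μ₀ (s₂ - s₃). -/
lemma eq_one_of_central {μ₀ μ₁ μ₂ s₁ s₂ s₃ P Q p q : ℂ} (h0 : μ₀ ≠ 0) (h2 : μ₂ ≠ 0)
    (hμ : μ₀ + μ₁ + μ₂ = 1) (hdet : P * q ≠ p * Q)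
    (hP : (μ₀ + μ₁) * s₃ * P + μ₂ * s₂ * (P + Q) - μ₂ * s₁ * Q = P)
    (hQ : (μ₁ + μ₂) * s₁ * Q + μ₀ * s₂ * (P + Q) - μ₀ * s₃ * P = Q)
    (hp : (μ₀ + μ₁) * s₃ * p + μ₂ * s₂ * (p + q) - μ₂ * s₁ * q = p)
    (hq : (μ₁ + μ₂) * s₁ * q + μ₀ * s₂ * (p + q) - μ₀ * s₃ * p = q) :
    s₁ = 1 ∧ s₂ = 1 ∧ s₃ = 1 := by
  have hdet' : P * q - p * Q ≠ 0 := sub_ne_zero.2 hdet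
  have h21 : s₂ - s₁ = 0 := by
    refine (mul_eq_zero.1 (?_ : (μ₂ * (P * q - p * Q)) * _ = 0)).resolve_left
      (mul_ne_zero h2 hdet')
    linear_combination P * hp - p * hP
  have h23 : s₂ - s₃ = 0 := by
    refine (mul_eq_zero.1 (?_ : (μ₀ * (P * q - p * Q)) * _ = 0)).resolve_left
      (mul_ne_zero h0 hdet')
    linear_combination q * hQ - Q * hq
  have h3 : (μ₀ + μ₁) * s₃ + μ₂ * s₂ - 1 = 0 := by
    refine (mul_eq_zero.1 (?_ : (P * q - p * Q) * _ = 0)).resolve_left hdet'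
    linear_combination q * hP - Q * hp
  have h4 : s₃ = 1 := by linear_combination h3 - μ₂ * h23 - s₃ * hμ
  exact ⟨by linear_combination h23 - h21 + h4, by linear_combination h23 + h4, h4⟩

/-! ### Necessity of the mass condition. -/

namespace DecoupledData

variable {m : Fin 3 → ℝ} {z w : Fin 3 → ℂ} {R : Fin 3 → Fin 3 → ℂ} {a : Fin 3 → ℂ} {μ : ℂ}

lemma sub_ne_zero_z (h : DecoupledData m z w R a μ) {i j : Fin 3} (hij : i ≠ j) :
    z i - z j ≠ 0 := fun h0 => h.ne_zero i j hij <| by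
  have := h.sq i j hij
  rw [h0, zero_mul] at this
  exact (pow_eq_zero_iff two_ne_zero).1 this

lemma sub_ne_zero_w (h : DecoupledData m z w R a μ) {i j : Fin 3} (hij : i ≠ j) :
    w i - w j ≠ 0 := fun h0 => h.ne_zero i j hij <| by
  have := h.sq i j hij
  rw [h0, mul_zero] at this
  exact (pow_eq_zero_iff two_ne_zero).1 this

lemma sum_dist_mul_sq (hm : ∀ i, 0 < m i) (h : DecoupledData m z w R a μ) :
    m 2 * (R 0 1 * (w 0 - w 1) ^ 2) + m 0 * (R 1 2 * (w 1 - w 2) ^ 2) +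
      m 1 * (R 2 0 * (w 2 - w 0) ^ 2) = 0 := by
  have hm' (i) : (m i : ℂ) ≠ 0 := by exact_mod_cast (hm i).ne'
  have key (i j : Fin 3) : (m j : ℂ) * (a i - a j) * (z i - z j) ^ 2 / R i j ^ 5 =
      (m j : ℂ) * (a i - a j) / (R i j * (w i - w j) ^ 2) := by
    rcases eq_or_ne i j with rfl | hij
    · simp
    · have h1 := h.ne_zero i j hij
      have h2 := h.sub_ne_zero_w hij
      have h3 := h.sq i j hij
      rw [div_eq_div_iff (pow_ne_zero 5 h1) (mul_ne_zero h1 (pow_ne_zero 2 h2))]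
      linear_combination -(m j : ℂ) * (a i - a j) * R i j *
        ((z i - z j) * (w i - w j) + R i j ^ 2) * h3
  have h0 := h.isotropic 0
  have h1 := h.isotropic 1
  simp only [key, Fin.sum_univ_three, sub_self, mul_zero, zero_div, zero_add, add_zero] at h0 h1
  rw [h.symm 0 2] at h0
  rw [h.symm 1 0] at h1
  have g3 : R 0 1 * (w 0 - w 1) ^ 2 ≠ 0 :=
    mul_ne_zero (h.ne_zero _ _ (by decide)) (pow_ne_zero 2 (h.sub_ne_zero_w (by decide)))
  have g1 : R 1 2 * (w 1 - w 2) ^ 2 ≠ 0 :=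
    mul_ne_zero (h.ne_zero _ _ (by decide)) (pow_ne_zero 2 (h.sub_ne_zero_w (by decide)))
  have g2 : R 2 0 * (w 2 - w 0) ^ 2 ≠ 0 :=
    mul_ne_zero (h.ne_zero _ _ (by decide)) (pow_ne_zero 2 (h.sub_ne_zero_w (by decide)))
  rw [show (w 0 - w 2) ^ 2 = (w 2 - w 0) ^ 2 by ring] at h0
  rw [show (w 1 - w 0) ^ 2 = (w 0 - w 1) ^ 2 by ring] at h1
  generalize R 0 1 * (w 0 - w 1) ^ 2 = G₃ at *
  generalize R 1 2 * (w 1 - w 2) ^ 2 = G₁ at *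
  generalize R 2 0 * (w 2 - w 0) ^ 2 = G₂ at *
  -- F is the circulation; it is nonzero because a is not constant.
  obtain ⟨F, hF⟩ : ∃ F, m 0 * m 1 * (a 0 - a 1) / G₃ = F := ⟨_, rfl⟩
  have e3 : m 0 * m 1 * (a 0 - a 1) = F * G₃ := by rw [← hF]; field_simp
  have e1 : m 1 * m 2 * (a 1 - a 2) = F * G₁ := by
    rw [← hF]
    field_simp at h1 ⊢
    linear_combination m 1 * h1
  have e2 : m 2 * m 0 * (a 2 - a 0) = F * G₂ := by
    rw [← hF]
    field_simp at h0 ⊢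
    linear_combination -m 0 * h0
  refine (mul_eq_zero.1 (?_ : F * _ = 0)).resolve_left ?_
  · linear_combination -m 2 * e3 - m 0 * e1 - m 1 * e2
  · rintro rfl
    have e01 : a 0 = a 1 := by simpa [hm', sub_eq_zero] using e3
    have e12 : a 1 = a 2 := by simpa [hm', sub_eq_zero] using e1
    obtain ⟨i, j, hij⟩ := h.nonconst
    apply hij
    fin_cases i <;> fin_cases j <;> simp [e01, e12]

lemma isExceptional (hm : ∀ i, 0 < m i) (hsum : m 0 + m 1 + m 2 = 1)
    (h : DecoupledData m z w R a μ) : IsExceptional m := by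
  have hm' (i) : (m i : ℂ) ≠ 0 := by exact_mod_cast (hm i).ne'
  have hsum' : (m 0 : ℂ) + m 1 + m 2 = 1 := by exact_mod_cast hsum
  have hA := h.sum_dist_mul_sq hm
  have h01 : (0 : Fin 3) ≠ 1 := by decide
  have h12 : (1 : Fin 3) ≠ 2 := by decide
  have h20 : (2 : Fin 3) ≠ 0 := by decide
  have r3 := h.ne_zero 0 1 h01
  have r1 := h.ne_zero 1 2 h12
  have r2 := h.ne_zero 2 0 h20
  have q3 := h.sq 0 1 h01
  have q1 := h.sq 1 2 h12
  have q2 := h.sq 2 0 h20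
  have p3 := h.sub_ne_zero_w h01
  have p1 := h.sub_ne_zero_w h12
  have p2 := h.sub_ne_zero_w h20
  have Z0 := h.central_z 0
  have Z1 := h.central_z 1
  have Z2 := h.central_z 2
  have W0 := h.central_w 0
  have W1 := h.central_w 1
  have W2 := h.central_w 2
  simp only [Fin.sum_univ_three, h.symm 1 0, h.symm 2 1, h.symm 0 2, sub_self, mul_zero, zero_mul,
    zero_add, add_zero, div_eq_mul_inv] at Z0 Z1 Z2 W0 W1 W2
  by_cases hdet : (z 0 - z 1) * (w 1 - w 2) = (w 0 - w 1) * (z 1 - z 2)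
  · obtain ⟨k, hk⟩ : ∃ k, z 0 - z 1 = k * (w 0 - w 1) :=
      ⟨(z 0 - z 1) / (w 0 - w 1), by field_simp⟩
    have hk1 : z 1 - z 2 = k * (w 1 - w 2) := by
      refine mul_left_cancel₀ p3 ?_
      linear_combination -hdet + (w 1 - w 2) * hk
    have hk2 : z 2 - z 0 = k * (w 2 - w 0) := by linear_combination -hk - hk1
    obtain ⟨κ, hκ⟩ := IsAlgClosed.exists_pow_nat_eq k (n := 2) (by norm_num)
    have hκ0 : κ ≠ 0 := by
      rintro rfl
      refine h.sub_ne_zero_z h01 ?_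
      rw [hk, ← hκ]; simp
    have sign {ρ x y : ℂ} (hρ : ρ ^ 2 = y * x) (hy : y = k * x) :
        ∃ d : ℂ, (d = 1 ∨ d = -1) ∧ ρ = d * (κ * x) := by
      have : ρ ^ 2 = (κ * x) ^ 2 := by rw [hρ, hy, ← hκ]; ring
      rcases sq_eq_sq_iff_eq_or_eq_neg.1 this with h | h
      · exact ⟨1, by simp, by simpa using h⟩
      · exact ⟨-1, by simp, by simpa using h⟩
    obtain ⟨d₃, hd3, e3⟩ := sign q3 hk
    obtain ⟨d₁, hd1, e1⟩ := sign q1 hk1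
    obtain ⟨d₂, hd2, e2⟩ := sign q2 hk2
    have c3 : d₃ ^ 3 = d₃ := by rcases hd3 with rfl | rfl <;> norm_num
    have c1 : d₁ ^ 3 = d₁ := by rcases hd1 with rfl | rfl <;> norm_num
    have c2 : d₂ ^ 3 = d₂ := by rcases hd2 with rfl | rfl <;> norm_num
    have hA' : m 2 * R 0 1 ^ 3 + m 0 * R 1 2 ^ 3 + m 1 * R 2 0 ^ 3 = 0 := by
      linear_combination k * hA + m 2 * R 0 1 * (q3 + (w 0 - w 1) * hk) +
        m 0 * R 1 2 * (q1 + (w 1 - w 2) * hk1) + m 1 * R 2 0 * (q2 + (w 2 - w 0) * hk2)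
    have hs : m 2 * (R 1 2 ^ 3)⁻¹ * (R 2 0 ^ 3)⁻¹ + m 0 * (R 0 1 ^ 3)⁻¹ * (R 2 0 ^ 3)⁻¹ +
        m 1 * (R 0 1 ^ 3)⁻¹ * (R 1 2 ^ 3)⁻¹ = 0 := by
      field_simp
      linear_combination hA'
    -- Given the relation `hs`, the central equations make each w_i the same multiple K of the cube
    -- of the opposite distance.
    have k02 : w 0 * (R 1 2 ^ 3)⁻¹ = w 2 * (R 0 1 ^ 3)⁻¹ := by
      linear_combination -(R 1 2 ^ 3)⁻¹ * W0 + (R 0 1 ^ 3)⁻¹ * W2 + (w 0 - w 2) * hs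
    have k12 : w 1 * (R 2 0 ^ 3)⁻¹ = w 2 * (R 0 1 ^ 3)⁻¹ := by
      linear_combination -(R 2 0 ^ 3)⁻¹ * W1 + (R 0 1 ^ 3)⁻¹ * W2 + (w 1 - w 2) * hs
    obtain ⟨K, hK⟩ : ∃ K, w 2 * (R 0 1 ^ 3)⁻¹ = K := ⟨_, rfl⟩
    rw [hK] at k02 k12
    have w2 : w 2 = K * κ ^ 3 * (d₃ * (w 0 - w 1) ^ 3) := by
      have : w 2 = K * R 0 1 ^ 3 := by rw [← hK]; field_simp
      rw [this, e3]
      linear_combination K * κ ^ 3 * (w 0 - w 1) ^ 3 * c3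
    have w0 : w 0 = K * κ ^ 3 * (d₁ * (w 1 - w 2) ^ 3) := by
      have : w 0 = K * R 1 2 ^ 3 := by rw [← k02]; field_simp
      rw [this, e1]
      linear_combination K * κ ^ 3 * (w 1 - w 2) ^ 3 * c1
    have w1 : w 1 = K * κ ^ 3 * (d₂ * (w 2 - w 0) ^ 3) := by
      have : w 1 = K * R 2 0 ^ 3 := by rw [← k12]; field_simp
      rw [this, e2]
      linear_combination K * κ ^ 3 * (w 2 - w 0) ^ 3 * c2
    refine isExceptional_of_signs hsum (K := K * κ ^ 3) p3 p1 p2 (by ring) hd1 hd2 hd3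
      (by linear_combination w0 - w1) (by linear_combination w1 - w2) ?_
    refine (mul_eq_zero.1 (?_ : κ * _ = 0)).resolve_left hκ0
    rw [e1, e2, e3] at hA
    linear_combination hA
  · obtain ⟨s1, s2, s3⟩ := eq_one_of_central (hm' 0) (hm' 2) hsum' hdet
      (s₁ := (R 1 2 ^ 3)⁻¹) (s₂ := (R 2 0 ^ 3)⁻¹) (s₃ := (R 0 1 ^ 3)⁻¹)
      (by linear_combination Z0 - Z1) (by linear_combination Z1 - Z2)
      (by linear_combination W0 - W1) (by linear_combination W1 - W2)
    rw [inv_eq_one] at s1 s2 s3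
    refine isExceptional_of_cube_eq_one hm hsum p3 p1 p2 (by ring) s1 s2 s3 ?_ hA
    rw [q1, q2, q3, mul_div_cancel_right₀ _ p3, mul_div_cancel_right₀ _ p1,
      mul_div_cancel_right₀ _ p2]
    ring

end DecoupledData

/-! ### Sufficiency: explicit configurations. -/

lemma DecoupledData.comp {m : Fin 3 → ℝ} {z w : Fin 3 → ℂ} {R : Fin 3 → Fin 3 → ℂ} {a : Fin 3 → ℂ}
    {μ : ℂ} (h : DecoupledData m z w R a μ) (σ : Equiv.Perm (Fin 3)) :
    DecoupledData (m ∘ σ) (z ∘ σ) (w ∘ σ) (fun i j => R (σ i) (σ j)) (a ∘ σ) μ where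
  symm i j := h.symm _ _
  sq i j hij := h.sq _ _ (σ.injective.ne hij)
  ne_zero i j hij := h.ne_zero _ _ (σ.injective.ne hij)
  central_z i := by
    refine Eq.trans ?_ (h.central_z (σ i))
    exact Equiv.sum_comp σ fun j => (m j : ℂ) * (z (σ i) - z j) / R (σ i) j ^ 3
  central_w i := by
    refine Eq.trans ?_ (h.central_w (σ i))
    exact Equiv.sum_comp σ fun j => (m j : ℂ) * (w (σ i) - w j) / R (σ i) j ^ 3
  norm_ne_zero := by
    have := h.norm_ne_zero
    rwa [← Equiv.sum_comp σ] at this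
  isotropic i := by
    rw [← h.isotropic (σ i)]
    exact Equiv.sum_comp σ fun j => (m j : ℂ) * (a (σ i) - a j) * (z (σ i) - z j) ^ 2 / R (σ i) j ^ 5
  eigen i := by
    rw [Function.comp_apply, ← h.eigen (σ i)]
    exact Equiv.sum_comp σ fun j => (m j : ℂ) * (a (σ i) - a j) / R (σ i) j ^ 3
  nonconst := by
    obtain ⟨i, j, hij⟩ := h.nonconst
    exact ⟨σ.symm i, σ.symm j, by simpa using hij⟩

lemma exists_decoupledData_of_comp {m : Fin 3 → ℝ} (σ : Equiv.Perm (Fin 3))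
    (h : ∃ z w R a μ, DecoupledData (m ∘ σ) z w R a μ) : ∃ z w R a μ, DecoupledData m z w R a μ := by
  obtain ⟨z, w, R, a, μ, h⟩ := h
  have hm : (m ∘ σ) ∘ σ.symm = m := by ext; simp
  exact ⟨_, _, _, _, _, hm ▸ h.comp σ.symm⟩

/-- A triangle with mutual distances `R`, `R³ = 1`, becomes a Darboux point after its centre of mass
is moved to the origin. -/
lemma exists_decoupledData_of_cube_eq_one {m : Fin 3 → ℝ} (hsum : m 0 + m 1 + m 2 = 1)
    {u v b : Fin 3 → ℂ} {R : Fin 3 → Fin 3 → ℂ} (hsymm : ∀ i j, R i j = R j i)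
    (hR : ∀ i j, R i j ^ 3 = 1) (hsq : ∀ i j, i ≠ j → R i j ^ 2 = (u i - u j) * (v i - v j))
    (hN : m 0 * m 1 * R 0 1 ^ 2 + m 1 * m 2 * R 1 2 ^ 2 + m 0 * m 2 * R 0 2 ^ 2 ≠ 0)
    (hA : ∀ i, ∑ j, (m j : ℂ) * (b i - b j) * (u i - u j) ^ 2 * R i j = 0)
    (hb : ∃ i j, b i ≠ b j) :
    ∃ z w R a μ, DecoupledData m z w R a μ := by
  have hsum' : (m 0 : ℂ) + m 1 + m 2 = 1 := by exact_mod_cast hsum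
  have hcm (f : Fin 3 → ℂ) (i : Fin 3) :
      ∑ j, (m j : ℂ) * (f i - ∑ k, m k * f k - (f j - ∑ k, m k * f k)) / R i j ^ 3 =
        f i - ∑ k, m k * f k := by
    simp only [hR, Fin.sum_univ_three]
    linear_combination f i * hsum'
  refine ⟨fun i => u i - ∑ j, m j * u j, fun i => v i - ∑ j, m j * v j, R,
    fun i => b i - ∑ j, m j * b j, 1, hsymm, ?_, ?_, hcm u, hcm v, ?_, ?_, ?_, ?_⟩
  · intro i j hij
    rw [hsq i j hij]; ring
  · intro i j _ h
    have := hR i j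
    rw [h] at this
    norm_num at this
  -- `hN` is the moment of inertia about the centre of mass, expressed by mutual distances.
  · rw [hsq 0 1 (by decide), hsq 1 2 (by decide), hsq 0 2 (by decide)] at hN
    convert hN using 1
    simp only [Fin.sum_univ_three]
    obtain h0 : (m 0 : ℂ) = 1 - m 1 - m 2 := by linear_combination hsum'
    rw [h0]
    ring
  · intro i
    rw [← hA i]
    refine Finset.sum_congr rfl fun j _ => ?_
    have h5 : R i j ^ 5 ≠ 0 := fun h => by
      have := hR i j
      rw [pow_eq_zero_iff (by norm_num) |>.1 h] at this
      norm_num at this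
    rw [div_eq_iff h5]
    linear_combination -(m j : ℂ) * (b i - b j) * (u i - u j) ^ 2 * (R i j ^ 3 + 1) * hR i j
  · simpa using hcm b
  · simpa using hb

lemma exists_decoupledData_of_eq_third {m : Fin 3 → ℝ} (hm : m = ![1 / 3, 1 / 3, 1 / 3]) :
    ∃ z w R a μ, DecoupledData m z w R a μ := by
  obtain ⟨x, hx⟩ : ∃ x : ℂ, x ^ 2 + x + 1 = 0 := by
    obtain ⟨s, hs⟩ := IsAlgClosed.exists_pow_nat_eq (-3 : ℂ) (n := 2) (by norm_num)
    exact ⟨(s - 1) / 2, by linear_combination hs / 4⟩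
  have m0 : m 0 = 1 / 3 := by simp [hm]
  have m1 : m 1 = 1 / 3 := by simp [hm]
  have m2 : m 2 = 1 / 3 := by simp [hm]
  refine exists_decoupledData_of_cube_eq_one (u := ![1, x, x ^ 2]) (v := ![1 / 3, x ^ 2 / 3, x / 3])
    (b := ![1, x, x ^ 2]) (R := fun _ _ => 1) ?_ ?_ ?_ ?_ ?_ ?_ ?_
  · rw [m0, m1, m2]; norm_num
  · simp
  · simp
  · intro i j hij
    fin_cases i <;> fin_cases j <;> simp at hij ⊢ <;> grind
  · rw [m0, m1, m2]; norm_num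
  · intro i
    simp only [Fin.sum_univ_three, m0, m1, m2]
    fin_cases i <;> simp <;> grind
  · refine ⟨0, 1, ?_⟩
    simp
    rintro rfl
    norm_num at hx

/-- Three bodies on a line through the origin, with distances that are not all positive. -/
lemma exists_decoupledData_of_collinear {m : Fin 3 → ℝ} (hm : ∀ i, 0 < m i) {x₀ x₁ x₂ p q t : ℂ}
    (hp : x₀ - x₁ = p) (hq : x₁ - x₂ = q) (ht : x₀ - x₂ = t) (hp0 : p ≠ 0) (hq0 : q ≠ 0)
    (ht0 : t ≠ 0) (h0 : m 1 * p⁻¹ ^ 2 + m 2 * t⁻¹ ^ 2 = x₀)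
    (h1 : m 2 * q⁻¹ ^ 2 - m 0 * p⁻¹ ^ 2 = x₁) (h2 : -m 0 * t⁻¹ ^ 2 - m 1 * q⁻¹ ^ 2 = x₂)
    (hN : m 0 * x₀ ^ 2 + m 1 * x₁ ^ 2 + m 2 * x₂ ^ 2 ≠ 0)
    (hA : m 2 * p ^ 3 + m 0 * q ^ 3 + m 1 * t ^ 3 = 0) :
    ∃ z w R a μ, DecoupledData m z w R a μ := by
  have hm2 : (m 2 : ℂ) ≠ 0 := by exact_mod_cast (hm 2).ne'
  have hp' : x₁ - x₀ = -p := by rw [← hp]; ring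
  have hq' : x₂ - x₁ = -q := by rw [← hq]; ring
  have ht' : x₂ - x₀ = -t := by rw [← ht]; ring
  have hcentral (i : Fin 3) : ∑ j, (m j : ℂ) * (![x₀, x₁, x₂] i - ![x₀, x₁, x₂] j) /
      ![![0, p, t], ![p, 0, q], ![t, q, 0]] i j ^ 3 = ![x₀, x₁, x₂] i := by
    fin_cases i <;> simp [Fin.sum_univ_three, hp, hq, ht, hp', hq', ht']
    · refine Eq.trans ?_ h0; field_simp
    · refine Eq.trans ?_ h1; field_simp; ring
    · refine Eq.trans ?_ h2; field_simp; ring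
  refine ⟨![x₀, x₁, x₂], ![x₀, x₁, x₂], ![![0, p, t], ![p, 0, q], ![t, q, 0]],
    -- This a is the circulation solution: a₀ - a₁ and a₁ - a₂ are m₂ p³ and m₀ q³, and `hA` closes
    -- the triangle.
    ![m 2 * p ^ 3, 0, -(m 0 * q ^ 3)], 0, ?_, ?_, ?_, hcentral, hcentral, ?_, ?_, ?_, ?_⟩
  · intro i j
    fin_cases i <;> fin_cases j <;> rfl
  · intro i j hij
    fin_cases i <;> fin_cases j <;> simp at hij ⊢ <;> grind
  · intro i j hij
    fin_cases i <;> fin_cases j <;> simp [hp0, hq0, ht0] at hij ⊢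
  · simpa [Fin.sum_univ_three, ← pow_two] using hN
  · intro i
    fin_cases i <;> simp [Fin.sum_univ_three, hp, hq, ht, hp', hq', ht'] <;> field_simp
    · linear_combination m 2 * hA
    · ring
    · linear_combination -m 0 * hA
  · intro i
    fin_cases i <;> simp [Fin.sum_univ_three] <;> field_simp
    · linear_combination m 2 * hA
    · ring
    · linear_combination -m 0 * hA
  · refine ⟨0, 1, ?_⟩
    simp [hm2, hp0]

lemma exists_decoupledData_of_eq_seventh {m : Fin 3 → ℝ} (hm : m = ![1 / 7, 5 / 7, 1 / 7]) :
    ∃ z w R a μ, DecoupledData m z w R a μ := by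
  obtain ⟨u, hu⟩ : ∃ u : ℂ, 2 * u ^ 2 + 3 * u + 2 = 0 := by
    obtain ⟨s, hs⟩ := IsAlgClosed.exists_pow_nat_eq (-7 : ℂ) (n := 2) (by norm_num)
    exact ⟨(s - 3) / 4, by linear_combination hs / 8⟩
  -- The root u is the ratio q/p of consecutive differences. The scale g, a cube root, normalises
  -- the multiplier to -1; the coordinates below have their centre of mass at 0.
  obtain ⟨g, hg⟩ := IsAlgClosed.exists_pow_nat_eq (-(10 * u + 67) / 12544 : ℂ) (n := 3) (by norm_num)
  have m0 : m 0 = 1 / 7 := by simp [hm]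
  have m1 : m 1 = 5 / 7 := by simp [hm]
  have m2 : m 2 = 1 / 7 := by simp [hm]
  have hg0 : g ≠ 0 := by grind
  have e01 : (6 * u + 8)⁻¹ = -(6 * u + 1) / 28 :=
    inv_eq_of_mul_eq_one_right (by linear_combination -9 / 14 * hu)
  have e12 : (-(u + 6))⁻¹ = (2 * u - 9) / 56 :=
    inv_eq_of_mul_eq_one_right (by linear_combination -1 / 56 * hu)
  have e02 : (5 * u + 2)⁻¹ = -(10 * u + 11) / 28 :=
    inv_eq_of_mul_eq_one_right (by linear_combination -25 / 28 * hu)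
  have n01 : 6 * u + 8 ≠ 0 := by grind
  have n12 : -(u + 6) ≠ 0 := by grind
  have n02 : 5 * u + 2 ≠ 0 := by grind
  have hgi : g = -(10 * u + 67) / 12544 * g⁻¹ ^ 2 := by rw [← hg]; field_simp
  refine exists_decoupledData_of_collinear (m := m) (fun i => ?_) (x₀ := g * (5 * u + 6))
    (x₁ := -g * (u + 2)) (x₂ := 4 * g) (p := g * (6 * u + 8)) (q := g * (-(u + 6)))
    (t := g * (5 * u + 2)) (by ring) (by ring) (by ring) (mul_ne_zero hg0 n01)
    (mul_ne_zero hg0 n12) (mul_ne_zero hg0 n02) ?_ ?_ ?_ ?_ ?_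
  · fin_cases i <;> simp [m0, m1, m2]
  · rw [m1, m2, mul_inv, mul_inv, e01, e02]
    push_cast
    grind
  · rw [m0, m2, mul_inv, mul_inv, e01, e12]
    push_cast
    grind
  · rw [m0, m1, mul_inv, mul_inv, e02, e12]
    push_cast
    grind
  · rw [m0, m1, m2]
    push_cast
    grind
  · rw [m0, m1, m2]
    push_cast
    grind

lemma exists_decoupledData_of_quadratic_relations {m : Fin 3 → ℝ} (hm : ∀ i, 0 < m i)
    (hs : m 0 + m 1 + m 2 = 1) (h1 : m 1 * (m 0 + m 2) = 5 * (m 0 * m 2))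
    (h2 : m 0 ^ 2 + m 1 ^ 2 + m 2 ^ 2 = 9 * (m 0 * m 2)) :
    ∃ z w R a μ, DecoupledData m z w R a μ := by
  have hm' (i) : (m i : ℂ) ≠ 0 := by exact_mod_cast (hm i).ne'
  have h1' : (m 1 : ℂ) * (m 0 + m 2) = 5 * (m 0 * m 2) := by exact_mod_cast h1
  have h2' : (m 0 : ℂ) ^ 2 + m 1 ^ 2 + m 2 ^ 2 = 9 * (m 0 * m 2) := by exact_mod_cast h2
  obtain ⟨x, hx⟩ : ∃ x : ℂ, m 0 * x ^ 2 + m 1 * x + m 2 = 0 := by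
    obtain ⟨s, hs⟩ := IsAlgClosed.exists_pow_nat_eq ((m 1 : ℂ) ^ 2 - 4 * m 0 * m 2) (n := 2)
      (by norm_num)
    refine ⟨(s - m 1) / (2 * m 0), ?_⟩
    have := hm' 0
    field_simp
    linear_combination hs
  -- Up to the factor m₀ m₂, the quartic is the quadratic of `hx` times its reciprocal polynomial.
  have hx4 : (1 + x) ^ 4 + x * (1 + x) ^ 2 + x ^ 2 = 0 := by
    refine (mul_eq_zero.1 (?_ : (m 0 * m 2 : ℂ) * _ = 0)).resolve_left
      (mul_ne_zero (hm' 0) (hm' 2))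
    linear_combination (m 2 * x ^ 2 + m 1 * x + m 0) * hx - (x ^ 3 + x) * h1' - x ^ 2 * h2'
  have hx0 : x ≠ 0 := by rintro rfl; norm_num at hx4
  have hx1 : 1 + x ≠ 0 := by intro h; rw [h] at hx4; simp [hx0] at hx4
  obtain ⟨y, hy⟩ : ∃ y, x * y = 1 := ⟨x⁻¹, mul_inv_cancel₀ hx0⟩
  obtain ⟨β, hβ⟩ : ∃ β, (1 + x) ^ 2 * β = x := ⟨x / (1 + x) ^ 2, by field_simp⟩
  have hβ2 : β ^ 2 + β + 1 = 0 := by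
    refine (mul_eq_zero.1 (?_ : (1 + x) ^ 4 * _ = 0)).resolve_left (pow_ne_zero 4 hx1)
    linear_combination ((1 + x) ^ 2 * β + x + (1 + x) ^ 2) * hβ + hx4
  have hβ3 : β ^ 3 = 1 := by linear_combination (β - 1) * hβ2
  have hβy : β ^ 2 = (1 + y) * (1 + x) := by
    linear_combination -β ^ 2 * y * hβ + (1 + x) ^ 2 * y * hβ3 + (1 + x - β ^ 2) * hy
  have hβz : (1 + y) ^ 2 * β = y := by
    linear_combination y ^ 2 * hβ + (y - β * (x * y + 1 + 2 * y)) * hy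
  -- Successive differences are 1, y in u and 1, x in v, with x y = 1; so two distances are 1 and
  -- the third is the cube root of unity β. The vector b is the circulation solution again.
  refine exists_decoupledData_of_cube_eq_one hs (u := ![0, -1, -(1 + y)]) (v := ![0, -1, -(1 + x)])
    (b := ![m 2, 0, -m 0 * x ^ 2]) (R := ![![1, 1, β], ![1, 1, 1], ![β, 1, 1]]) ?_ ?_ ?_ ?_ ?_ ?_
  · intro i j
    fin_cases i <;> fin_cases j <;> rfl
  · intro i j
    fin_cases i <;> fin_cases j <;> simp [hβ3]
  · intro i j hij
    fin_cases i <;> fin_cases j <;> simp at hij ⊢ <;> grind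
  · simp
    intro h
    have h5 : β ^ 2 = -5 := by
      refine mul_left_cancel₀ (mul_ne_zero (hm' 0) (hm' 2)) ?_
      linear_combination h - h1'
    grind
  · intro i
    fin_cases i <;> simp [Fin.sum_univ_three]
    · linear_combination m 2 * (m 0 * x ^ 2 + m 2) * hβz + m 2 * y * hx - m 1 * m 2 * hy
    · linear_combination m 2 * m 0 * (x * y + 1) * hy
    · linear_combination -m 0 * (m 0 * x ^ 2 + m 2) * hβz - m 0 * y * hx - m 0 * m 1 * x * y * hy
  · refine ⟨0, 1, ?_⟩
    simpa using hm' 2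

lemma exists_decoupledData_of_isExceptional {m : Fin 3 → ℝ} (hm : ∀ i, 0 < m i)
    (h : IsExceptional m) :
    ∃ z w R a μ, DecoupledData m z w R a μ := by
  obtain ⟨σ, h⟩ := h
  refine exists_decoupledData_of_comp σ ?_
  rcases h with h | h | h
  · exact exists_decoupledData_of_eq_third h
  · exact exists_decoupledData_of_eq_seventh h
  · have h21 : √21 ^ 2 = 21 := Real.sq_sqrt (by norm_num)
    have hT : √(126 + 42 * √21) ^ 2 = 126 + 42 * √21 := Real.sq_sqrt (by positivity)
    have e0 := congrFun h 0
    have e1 := congrFun h 1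
    have e2 := congrFun h 2
    simp only [Matrix.cons_val] at e0 e1 e2
    generalize √(126 + 42 * √21) = T at *
    generalize √21 = s at *
    refine exists_decoupledData_of_quadratic_relations (fun i => hm (σ i)) ?_ ?_ ?_
    · rw [e0, e1, e2]; ring
    · rw [e0, e1, e2]; grind
    · rw [e0, e1, e2]; grind

end PlanarNBody

theorem theorem12 (m : Fin 3 → ℝ) (hm : ∀ i, 0 < m i) (hsum : m 0 + m 1 + m 2 = 1) :
    (∃ (c : PlanarNBody.Config 3) (r : Fin 3 → Fin 3 → PlanarNBody.Config 3 → ℂ),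
      PlanarNBody.IsDistanceBranch r c ∧
      PlanarNBody.IsDarbouxPoint m (PlanarNBody.potential m r) c (-1) ∧
      PlanarNBody.massNormSq m c ≠ 0 ∧
      PlanarNBody.IsPartiallyDecoupled m (PlanarNBody.potential m r) c) ↔
    ∃ σ : Equiv.Perm (Fin 3),
      m ∘ σ = ![1 / 3, 1 / 3, 1 / 3] ∨
      m ∘ σ = ![1 / 7, 5 / 7, 1 / 7] ∨
      m ∘ σ = ![1 / 4 + (√21 + √(126 + 42 * √21)) / 84,
                1 / 2 - √21 / 42,
                1 / 4 + (√21 - √(126 + 42 * √21)) / 84] := by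
  rw [PlanarNBody.exists_isPartiallyDecoupled_iff hm]
  constructor
  · rintro ⟨z, w, R, a, μ, h⟩
    exact h.isExceptional hm hsum
  · exact PlanarNBody.exists_decoupledData_of_isExceptional hm
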